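/- Let $(M,g)$ be a smooth Riemannian manifold, and let $M\times S^1$ carry the product metric $g+d\sigma^2$, where $d\sigma^2$ is the standard metric of the unit circle. For an immersed closed curve let $s$ be the arc length, $T$ the unit tangent vector and $\frac{D}{\partial s}$ the covariant derivative along the curve. The curve is called a *ramp* if there is a (smooth) unit tangent vector field $U$ on $S^1$ with $\langle(\pi_{S^1})_*T,U\rangle>0$ along the curve, where $\pi_{S^1}:M\times S^1\to S^1$ is the projection. A *curve shortening flow* on $[0,\tau)$, $0<\tau\le\infty$, is a smooth family of immersed closed curves $\gamma_t=\gamma(\cdot,t):S^1\to M\times S^1$, $t\in[0,\tau)$, with $\frac{\partial\gamma}{\partial t}=\frac{DT}{\partial s}$. A *signed curvature* of the flow is a function $k(\cdot,t)$, continuous on $S^1$ for each $t$, with $\frac{DT}{\partial s}=kN$ for a unit normal field $N$ along $\gamma_t$. Let $\gamma_0:S^1\to M\times S^1$ be a smooth immersed closed curve that is a ramp. Then there are constants $C_1<0$ and $C_2>0$, depending only on $\gamma_0$ (and on $(M,g)$), such that the following holds for every $\Xi>0$ that is an upper bound of the sectional curvature of $M\times S^1$, every $\tau\in(0,\infty]$,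 and every curve shortening flow $(\gamma_t)_{t\in[0,\tau)}$ that starts at $\gamma_0$. The curve $\gamma_t$ is a ramp for every $t\in[0,\tau)$, and for every signed curvature $k$ of the flow: (1) if $\min_{S^1}k(\cdot,t)<0$ for all $t\in[0,\tau)$, then $k(\cdot,t)\ge C_1e^{\Xi t}$ for all $t\in[0,\tau)$; (2) if $\max_{S^1}k(\cdot,t)>0$ for all $t\in[0,\tau)$, then $k(\cdot,t)\le C_2e^{\Xi t}$ for all $t\in[0,\tau)$. -/

import Mathlib

open scoped Manifold ContDiff

noncomputable section

/-! ### Riemannian metrics in linear coordinates -/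

section Coordinates

variable {E : Type*} [NormedAddCommGroup E] [NormedSpace ℝ E]

/-- The covector `z ↦ (∂_v G(w, z) + ∂_w G(v, z) - ∂_z G(v, w)) / 2`
(Christoffel symbols of the first kind) of a metric `G` on (an open part of) `E`. -/
def christoffelFirst (G : E → E →L[ℝ] E →L[ℝ] ℝ) (y v w : E) : E →L[ℝ] ℝ :=
  (1 / 2 : ℝ) • (fderiv ℝ G y v w + fderiv ℝ G y w v - ((fderiv ℝ G y).flip v).flip w)

/-- The Christoffel symbols `Γ_y(v, w)`: the index of `christoffelFirst` is raised with the inverse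
of `G y : E → E*`. -/
def christoffel (G : E → E →L[ℝ] E →L[ℝ] ℝ) (y v w : E) : E :=
  (G y).inverse (christoffelFirst G y v w)

/-- The Riemann curvature `R(a, b)c = ∇_a ∇_b c - ∇_b ∇_a c` of the metric `G` at `y`
(for constant fields `a`, `b`, `c`). -/
def riemannCurvature (G : E → E →L[ℝ] E →L[ℝ] ℝ) (y a b c : E) : E :=
  fderiv ℝ (fun y' => christoffel G y' b c) y a - fderiv ℝ (fun y' => christoffel G y' a c) y b
    + christoffel G y a (christoffel G y b c) - christoffel G y b (christoffel G y a c)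

end Coordinates

/-! ### Riemannian geometry of curves on a manifold -/

section Manifold

variable {E : Type*} [NormedAddCommGroup E] [NormedSpace ℝ E]
  {H : Type*} [TopologicalSpace H] (I : ModelWithCorners ℝ E H)
  {X : Type*} [TopologicalSpace X] [ChartedSpace H X]
  (g : ∀ x : X, TangentSpace I x →L[ℝ] TangentSpace I x →L[ℝ] ℝ)

/-- The metric `g` in the preferred chart around `x`: its pullback by the inverse of the chart. -/
def chartMetric (x : X) (y : E) : E →L[ℝ] E →L[ℝ] ℝ :=
  let p : X := (extChartAt I x).symm y
  let A : E →L[ℝ] E := mfderiv 𝓘(ℝ, E) I (extChartAt I x).symm y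
  let B : E →L[ℝ] E →L[ℝ] ℝ := g p
  B.bilinearComp A A

/-- The sectional curvature of `g` at `x` of the plane spanned by `v` and `w`. -/
def sectionalCurvature (x : X) (v w : TangentSpace I x) : ℝ :=
  let y : E := extChartAt I x x
  let a : E := mfderiv I 𝓘(ℝ, E) (extChartAt I x) x v
  let b : E := mfderiv I 𝓘(ℝ, E) (extChartAt I x) x w
  let G := chartMetric I g x
  G y (riemannCurvature G y a b b) a / (G y a a * G y b b - G y a b ^ 2)

/-- All sectional curvatures of `g` are at most `Ξ`. -/
def SectionalCurvatureLE (Ξ : ℝ) : Prop :=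
  ∀ (x : X) (v w : TangentSpace I x), LinearIndependent ℝ ![v, w] →
    sectionalCurvature I g x v w ≤ Ξ

/-- The velocity `dc/da` of a curve. -/
def velocity (c : ℝ → X) (a : ℝ) : TangentSpace I (c a) :=
  mfderiv 𝓘(ℝ, ℝ) I c a (1 : ℝ)

/-- The speed `|dc/da|`. -/
def speed (c : ℝ → X) (a : ℝ) : ℝ :=
  √(g (c a) (velocity I c a) (velocity I c a))

/-- The unit tangent vector `T`. -/
def unitTangent (c : ℝ → X) (a : ℝ) : TangentSpace I (c a) :=
  (speed I g c a)⁻¹ • velocity I c a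

/-- The (Levi-Civita) covariant derivative `DV/∂a` of a vector field `V` along a curve `c`:
in the preferred chart around `c a` it is `V' + Γ(c', V)`. -/
def covDerivAlong (c : ℝ → X) (V : ∀ a, TangentSpace I (c a)) (a : ℝ) : TangentSpace I (c a) :=
  let y : E := extChartAt I (c a) (c a)
  let c' : E := deriv (fun b => extChartAt I (c a) (c b)) a
  let W : ℝ → E := fun b => mfderiv I 𝓘(ℝ, E) (extChartAt I (c a)) (c b) (V b)
  let D : E := deriv W a + christoffel (chartMetric I g (c a)) y c' (W a)
  (mfderiv 𝓘(ℝ, E) I (extChartAt I (c a)).symm y : E →L[ℝ] E) D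

/-- The curvature vector `DT/∂s`, where `∂/∂s = |dc/da|⁻¹ ∂/∂a`. -/
def curvatureVector (c : ℝ → X) (a : ℝ) : TangentSpace I (c a) :=
  (speed I g c a)⁻¹ • covDerivAlong I g c (unitTangent I g c) a

/-- The parametrization over `ℝ`, by the angle, of a closed curve. -/
def angular (γ : Circle → X) : ℝ → X := fun a => γ (Circle.exp a)

/-- `γ` is a smooth immersed closed curve. -/
def IsImmersedCurve (γ : Circle → X) : Prop :=
  ContMDiff (𝓡 1) I ∞ γ ∧ ∀ a, velocity I (angular γ) a ≠ 0

/-- The time interval `[0, τ)`, where `τ = ⊤` is allowed. -/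
def timeInterval (τ : EReal) : Set ℝ := {t | 0 ≤ t ∧ (t : EReal) < τ}

/-- `γ : S¹ × [0, τ) → X` is a curve shortening flow: a smooth family of immersed closed curves
with `∂γ/∂t = DT/∂s` (at `t = 0` the time derivative is one-sided). -/
structure IsCurveShorteningFlow (τ : EReal) (γ : Circle → ℝ → X) : Prop where
  smooth : ContMDiffOn ((𝓡 1).prod 𝓘(ℝ, ℝ)) I ∞ (Function.uncurry γ)
    (Set.univ ×ˢ timeInterval τ)
  immersed : ∀ t ∈ timeInterval τ, IsImmersedCurve I (fun z => γ z t)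
  evolution : ∀ t ∈ timeInterval τ, ∀ a : ℝ,
    mfderivWithin 𝓘(ℝ, ℝ) I (γ (Circle.exp a)) (timeInterval τ) t (1 : ℝ)
      = curvatureVector I g (angular fun z => γ z t) a

/-- `k` is a signed curvature function of the closed curve `γ`: a continuous function on `S¹` such
that `DT/∂s = k N` for a unit normal field `N` along `γ`. No regularity of `N` is required. -/
def IsSignedCurvature (γ : Circle → X) (k : Circle → ℝ) : Prop :=
  Continuous k ∧ ∃ N : ∀ z : Circle, TangentSpace I (γ z),
    (∀ z, g (γ z) (N z) (N z) = 1) ∧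
    (∀ a : ℝ, g (γ (Circle.exp a)) (N (Circle.exp a)) (unitTangent I g (angular γ) a) = 0) ∧
    ∀ a : ℝ, curvatureVector I g (angular γ) a = k (Circle.exp a) • N (Circle.exp a)

end Manifold

/-! ### The product of a Riemannian manifold with the unit circle -/

/-- The standard metric `dσ²` of the unit circle, induced from `ℂ`. -/
def circleMetric (z : Circle) : TangentSpace (𝓡 1) z →L[ℝ] TangentSpace (𝓡 1) z →L[ℝ] ℝ :=
  let A : EuclideanSpace ℝ (Fin 1) →L[ℝ] ℂ :=
    mfderiv (𝓡 1) 𝓘(ℝ, ℂ) (fun z' : Circle => (z' : ℂ)) z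
  (innerSL ℝ : ℂ →L[ℝ] ℂ →L[ℝ] ℝ).bilinearComp A A

section Product

variable {n : ℕ} {M : Type*} [TopologicalSpace M] [ChartedSpace (EuclideanSpace ℝ (Fin n)) M]

/-- The product metric `g + dσ²` on `M × S¹`. -/
def productMetric (g : ∀ x : M, TangentSpace (𝓡 n) x →L[ℝ] TangentSpace (𝓡 n) x →L[ℝ] ℝ)
    (p : M × Circle) : TangentSpace ((𝓡 n).prod (𝓡 1)) p →L[ℝ]
      TangentSpace ((𝓡 n).prod (𝓡 1)) p →L[ℝ] ℝ :=
  let P : EuclideanSpace ℝ (Fin n) × EuclideanSpace ℝ (Fin 1) →L[ℝ] EuclideanSpace ℝ (Fin n) :=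
    mfderiv ((𝓡 n).prod (𝓡 1)) (𝓡 n) (Prod.fst : M × Circle → M) p
  let Q : EuclideanSpace ℝ (Fin n) × EuclideanSpace ℝ (Fin 1) →L[ℝ] EuclideanSpace ℝ (Fin 1) :=
    mfderiv ((𝓡 n).prod (𝓡 1)) (𝓡 1) (Prod.snd : M × Circle → Circle) p
  let g₁ : EuclideanSpace ℝ (Fin n) →L[ℝ] EuclideanSpace ℝ (Fin n) →L[ℝ] ℝ := g p.1
  let g₂ : EuclideanSpace ℝ (Fin 1) →L[ℝ] EuclideanSpace ℝ (Fin 1) →L[ℝ] ℝ := circleMetric p.2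
  g₁.bilinearComp P P + g₂.bilinearComp Q Q

/-- A closed curve in `(M × S¹, g + dσ²)` is a ramp if there is a smooth unit tangent vector field
`U` on `S¹` with `⟨(π_{S¹})_* T, U⟩ > 0` along the curve. -/
def IsRamp (g : ∀ x : M, TangentSpace (𝓡 n) x →L[ℝ] TangentSpace (𝓡 n) x →L[ℝ] ℝ)
    (γ : Circle → M × Circle) : Prop :=
  ∃ U : ∀ z : Circle, TangentSpace (𝓡 1) z,
    ContMDiff (𝓡 1) (𝓡 1).tangent ∞ (fun z => (⟨z, U z⟩ : TangentBundle (𝓡 1) Circle)) ∧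
    (∀ z, circleMetric z (U z) (U z) = 1) ∧
    ∀ a : ℝ, 0 < circleMetric (angular γ a).2
      (mfderiv ((𝓡 n).prod (𝓡 1)) (𝓡 1) (Prod.snd : M × Circle → Circle) (angular γ a)
        (unitTangent ((𝓡 n).prod (𝓡 1)) (productMetric g) (angular γ) a))
      (U (angular γ a).2)

end Product

end

/-! The field U is, up to a sign r, the rotation field of the circle. The one-form θ = r dσ is
parallel on M × S¹ because the metric splits. Write T for the unit tangent, K = DT/∂s for the
curvature vector, P = DK/∂s and u = θ(T); for the given U the ramp condition is u > 0.

Since D_t T = P + |K|²T and θ is parallel, u_t = u_ss + |K|²u, so the minimum principle keeps u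
positive (`formTangent_pos`). Commuting D_t with D_s gives D_t K = D_s P + (|K|²)_s T + 2|K|²K +
R(K,T)T. For c > Ξ consider w = |K|² - B e^{2ct} u², with B so large that w < 0 at time zero. At a
first zero of w one has w_s = 0, w_ss ≤ 0 and w_t ≥ 0. There w_s = 0 says ⟨P,K⟩ = B e^{2ct} u θ(K).
As ⟨P,T⟩ = -|K|², Bessel's inequality yields |P|² ≥ |K|⁴ + B e^{2ct} θ(K)². These gradient terms
absorb everything in w_t except the curvature term and the growth of the exponential, so w_t ≤
2⟨R(K,T)T,K⟩ - 2c|K|² ≤ 2(Ξ - c)|K|² < 0, a contradiction. Letting c tend to Ξ gives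
`curvatureSq_le`. Finally u² ≤ 1 and k² = |K|², hence |k| ≤ √B e^{Ξt}, and the constants are -√B and
√B. Only |K|² enters, so the dimension of M plays no role.

The two pointwise contradictions are `no_first_zero_form` and `no_first_zero_curvature`, proved in
one fixed chart on an open set of positive times. `exists_isChartFlow` supplies the chart, and
`neg_of_no_first_zero` finds the first zero from compactness of the circle and continuity up to time
zero. -/

noncomputable section

set_option maxSynthPendingDepth 3

/-! ### Riemannian metrics on open subsets of a vector space -/

section LocalMetric

variable {E : Type*} [NormedAddCommGroup E] [NormedSpace ℝ E]

/-- `G` is a smooth Riemannian metric on the open set `O`. -/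
structure IsLocalMetric (G : E → E →L[ℝ] E →L[ℝ] ℝ) (O : Set E) : Prop where
  isOpen : IsOpen O
  smooth : ContDiffOn ℝ ∞ G O
  symm : ∀ y ∈ O, ∀ v w, G y v w = G y w v
  pos : ∀ y ∈ O, ∀ v, v ≠ 0 → 0 < G y v v

/-- The first Christoffel symbols as a bilinear map with values in the dual space. -/
def christoffelFirstCLM (G : E → E →L[ℝ] E →L[ℝ] ℝ) (y : E) : E →L[ℝ] E →L[ℝ] E →L[ℝ] ℝ :=
  (1 / 2 : ℝ) • (fderiv ℝ G y + (fderiv ℝ G y).flip -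
    (ContinuousLinearMap.flipₗᵢ ℝ E E ℝ).toContinuousLinearEquiv.toContinuousLinearMap.comp
      (fderiv ℝ G y).flip)

lemma christoffelFirstCLM_apply (G : E → E →L[ℝ] E →L[ℝ] ℝ) (y v w : E) :
    christoffelFirstCLM G y v w = christoffelFirst G y v w := by
  simp [christoffelFirstCLM, christoffelFirst]

/-- The Christoffel symbols as a bilinear map. -/
def christoffelCLM (G : E → E →L[ℝ] E →L[ℝ] ℝ) (y : E) : E →L[ℝ] E →L[ℝ] E :=
  (ContinuousLinearMap.compL ℝ E (E →L[ℝ] ℝ) E (G y).inverse).comp (christoffelFirstCLM G y)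

lemma christoffelCLM_apply (G : E → E →L[ℝ] E →L[ℝ] ℝ) (y v w : E) :
    christoffelCLM G y v w = christoffel G y v w := by
  simp [christoffelCLM, christoffel, christoffelFirstCLM_apply]

lemma christoffelFirst_apply (G : E → E →L[ℝ] E →L[ℝ] ℝ) (y v w z : E) :
    christoffelFirst G y v w z =
      1 / 2 * (fderiv ℝ G y v w z + fderiv ℝ G y w v z - fderiv ℝ G y z v w) := by
  simp [christoffelFirst]

namespace IsLocalMetric

variable {G : E → E →L[ℝ] E →L[ℝ] ℝ} {O : Set E} (hG : IsLocalMetric G O)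
  {y : E}
include hG

lemma differentiableAt (hy : y ∈ O) : DifferentiableAt ℝ G y :=
  (hG.smooth.contDiffAt (hG.isOpen.mem_nhds hy)).differentiableAt (by simp)

lemma ext_of_apply (hy : y ∈ O) {v w : E} (h : ∀ z, G y v z = G y w z) : v = w := by
  by_contra hne
  have h1 := hG.pos y hy (v - w) (sub_ne_zero.2 hne)
  have h2 : G y (v - w) (v - w) = 0 := by
    rw [map_sub]; simp [h]
  linarith

lemma fderiv_symm (hy : y ∈ O) (a v w : E) : fderiv ℝ G y a v w = fderiv ℝ G y a w v := by
  have key : ∀ v w, HasFDerivAt (fun y' => G y' v w) _ y := fun v w =>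
    ((hG.differentiableAt hy).hasFDerivAt.clm_apply (hasFDerivAt_const v y)).clm_apply
      (hasFDerivAt_const w y)
  have h2 : (fun y' => G y' v w) =ᶠ[nhds y] fun y' => G y' w v :=
    Filter.eventually_of_mem (hG.isOpen.mem_nhds hy) fun y' hy' => hG.symm y' hy' v w
  have h3 := ((key w v).congr_of_eventuallyEq h2).unique (key v w)
  simpa using (DFunLike.congr_fun h3 a).symm

variable [FiniteDimensional ℝ E]

/-- `ContinuousLinearMap.inverse` is zero at maps that are not invertible, so invertibility must be
known before an index is raised. Injectivity suffices because a finite-dimensional space and its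
dual have equal dimension. -/
lemma exists_equiv (hy : y ∈ O) : ∃ e : E ≃L[ℝ] (E →L[ℝ] ℝ), (e : E →L[ℝ] (E →L[ℝ] ℝ)) = G y := by
  have hinj : Function.Injective (G y : E →ₗ[ℝ] (E →L[ℝ] ℝ)) := fun v w h =>
    hG.ext_of_apply hy fun z => DFunLike.congr_fun h z
  have hdim : Module.finrank ℝ E = Module.finrank ℝ (E →L[ℝ] ℝ) := by
    rw [← (LinearMap.toContinuousLinearMap (𝕜 := ℝ) (E := E) (F' := ℝ)).finrank_eq]
    exact (Subspace.dual_finrank_eq (K := ℝ) (V := E)).symm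
  refine ⟨(LinearEquiv.ofInjectiveOfFinrankEq _ hinj hdim).toContinuousLinearEquiv, ?_⟩
  ext v w
  rfl

lemma apply_inverse (hy : y ∈ O) (l : E →L[ℝ] ℝ) : G y ((G y).inverse l) = l := by
  obtain ⟨e, he⟩ := hG.exists_equiv hy
  rw [← he, ContinuousLinearMap.inverse_equiv]
  simp

lemma apply_christoffel (hy : y ∈ O) (v w z : E) :
    G y (christoffel G y v w) z = christoffelFirst G y v w z := by
  rw [christoffel, hG.apply_inverse hy]

/-- Torsion-freeness: in the Koszul formula the first two terms trade places and the third is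
symmetric. -/
lemma christoffel_symm (hy : y ∈ O) (v w : E) : christoffel G y v w = christoffel G y w v := by
  refine hG.ext_of_apply hy fun z => ?_
  rw [hG.apply_christoffel hy, hG.apply_christoffel hy, christoffelFirst_apply,
    christoffelFirst_apply, hG.fderiv_symm hy z v w]
  ring

/-- Compatibility of the connection with the metric: in the sum of the two Koszul expressions only
the derivative in direction `a` survives. -/
lemma fderiv_eq (hy : y ∈ O) (a v w : E) :
    fderiv ℝ G y a v w = G y (christoffel G y a v) w + G y v (christoffel G y a w) := by
  rw [hG.symm y hy v, hG.apply_christoffel hy, hG.apply_christoffel hy, christoffelFirst_apply,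
    christoffelFirst_apply, hG.fderiv_symm hy w a v, hG.fderiv_symm hy a w v,
    hG.fderiv_symm hy v a w]
  ring

lemma contDiffOn_christoffelCLM : ContDiffOn ℝ ∞ (christoffelCLM G) O := by
  have h1 : ContDiffOn ℝ ∞ (fderiv ℝ G) O := hG.smooth.fderiv_of_isOpen hG.isOpen (by simp)
  have hflip : ContDiffOn ℝ ∞ (fun y => (fderiv ℝ G y).flip) O :=
    (ContinuousLinearMap.flipₗᵢ ℝ E E (E →L[ℝ] ℝ)).contDiff.comp_contDiffOn h1
  have h2 : ContDiffOn ℝ ∞ (christoffelFirstCLM G) O :=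
    ((h1.add hflip).sub (contDiffOn_const.clm_comp hflip)).const_smul _
  have h3 : ContDiffOn ℝ ∞ (fun y => (G y).inverse) O := by
    intro y hy
    obtain ⟨e, he⟩ := hG.exists_equiv hy
    have := contDiffAt_map_inverse (𝕜 := ℝ) (n := ∞) e
    rw [he] at this
    exact this.comp_contDiffWithinAt y (hG.smooth y hy)
  exact ((ContinuousLinearMap.compL ℝ E (E →L[ℝ] ℝ) E).contDiff.comp_contDiffOn h3).clm_comp h2

/-- The Christoffel symbols of the pullback metric. -/
lemma fderiv_christoffel_pullback {G' : E → E →L[ℝ] E →L[ℝ] ℝ} {O' : Set E}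
    (hG' : IsLocalMetric G' O') {φ : E → E} {y : E} (hy : y ∈ O') (hφy : φ y ∈ O)
    (hφ : ContDiffAt ℝ ∞ φ y) (hsurj : Function.Surjective (fderiv ℝ φ y))
    (hpull : ∀ᶠ y' in nhds y, ∀ v w, G' y' v w = G (φ y') (fderiv ℝ φ y' v) (fderiv ℝ φ y' w))
    (v w : E) :
    fderiv ℝ φ y (christoffel G' y v w) =
      christoffel G (φ y) (fderiv ℝ φ y v) (fderiv ℝ φ y w) + fderiv ℝ (fderiv ℝ φ) y v w := by
  have hd2 : HasFDerivAt (fderiv ℝ φ) (fderiv ℝ (fderiv ℝ φ) y) y :=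
    ((hφ.fderiv_right (m := 1) (by norm_cast)).differentiableAt (by simp)).hasFDerivAt
  have hd1 : HasFDerivAt φ (fderiv ℝ φ y) y := (hφ.differentiableAt (by simp)).hasFDerivAt
  have hGd := (hG.differentiableAt hφy).hasFDerivAt.comp y hd1
  have hsymm : ∀ a b, fderiv ℝ (fderiv ℝ φ) y a b = fderiv ℝ (fderiv ℝ φ) y b a := by
    have := hφ.isSymmSndFDerivAt (by simp; norm_cast)
    exact fun a b => this a b
  -- Product rule for the pulled-back metric. In the Koszul combination the symmetry of D²φ cancels
  -- all its occurrences except the term ⟨D²φ(v,w), Dφ z⟩.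
  have key : ∀ a b c, fderiv ℝ G' y a b c =
      fderiv ℝ G (φ y) (fderiv ℝ φ y a) (fderiv ℝ φ y b) (fderiv ℝ φ y c) +
      G (φ y) (fderiv ℝ (fderiv ℝ φ) y a b) (fderiv ℝ φ y c) +
      G (φ y) (fderiv ℝ φ y b) (fderiv ℝ (fderiv ℝ φ) y a c) := by
    intro a b c
    have e1 : HasFDerivAt (fun y' => G' y' b c) _ y :=
      ((hG'.differentiableAt hy).hasFDerivAt.clm_apply (hasFDerivAt_const b y)).clm_apply
        (hasFDerivAt_const c y)
    have e2 : HasFDerivAt (fun y' => G (φ y') (fderiv ℝ φ y' b) (fderiv ℝ φ y' c)) _ y :=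
      (hGd.clm_apply (hd2.clm_apply (hasFDerivAt_const b y))).clm_apply
        (hd2.clm_apply (hasFDerivAt_const c y))
    have e3 : (fun y' => G' y' b c) =ᶠ[nhds y]
        fun y' => G (φ y') (fderiv ℝ φ y' b) (fderiv ℝ φ y' c) := hpull.mono fun y' h => h b c
    have := DFunLike.congr_fun (e1.unique (e2.congr_of_eventuallyEq e3)) a
    simp at this
    rw [this]; ring
  refine hG.ext_of_apply hφy fun z => ?_
  obtain ⟨z, rfl⟩ := hsurj z
  rw [← hpull.self_of_nhds, hG'.apply_christoffel hy, christoffelFirst_apply, map_add,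
    add_apply, hG.apply_christoffel hφy, christoffelFirst_apply, key, key, key,
    hsymm w v, hsymm z v, hsymm z w, hG.symm _ hφy (fderiv ℝ φ y w),
    hG.symm _ hφy (fderiv ℝ φ y v)]
  ring

end IsLocalMetric

/-- A one-form `η` with symmetric derivative which splits off the metric orthogonally
is parallel. -/
lemma IsLocalMetric.parallel_of_splitting {E₁ E₂ : Type*} [NormedAddCommGroup E₁]
    [NormedSpace ℝ E₁] [NormedAddCommGroup E₂] [NormedSpace ℝ E₂] [FiniteDimensional ℝ E₁]
    [FiniteDimensional ℝ E₂] {G : E₁ × E₂ → (E₁ × E₂) →L[ℝ] (E₁ × E₂) →L[ℝ] ℝ}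
    {O : Set (E₁ × E₂)} (hG : IsLocalMetric G O) {G₁ : E₁ → E₁ →L[ℝ] E₁ →L[ℝ] ℝ}
    {η : E₂ → E₂ →L[ℝ] ℝ} {y : E₁ × E₂} (hy : y ∈ O)
    (hη : DifferentiableAt ℝ η y.2) (hclosed : ∀ v w, fderiv ℝ η y.2 v w = fderiv ℝ η y.2 w v)
    (hne : η y.2 ≠ 0)
    (hsplit : ∀ y ∈ O, ∀ v w, G y v w = G₁ y.1 v.1 w.1 + η y.2 v.2 * η y.2 w.2)
    (v w : E₁ × E₂) : η y.2 (christoffel G y v w).2 = fderiv ℝ η y.2 v.2 w.2 := by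
  obtain ⟨u, hu⟩ : ∃ u, η y.2 u ≠ 0 := by
    by_contra! h
    exact hne (ContinuousLinearMap.ext h)
  have hη' : HasFDerivAt (fun y' : E₁ × E₂ => η y'.2)
      ((fderiv ℝ η y.2).comp (ContinuousLinearMap.snd ℝ E₁ E₂)) y :=
    hη.hasFDerivAt.comp y hasFDerivAt_snd
  have hO := hG.isOpen.mem_nhds hy
  have hd : ∀ v w, HasFDerivAt (fun y' => G y' v w) _ y := fun v w =>
    ((hG.differentiableAt hy).hasFDerivAt.clm_apply (hasFDerivAt_const v y)).clm_apply
      (hasFDerivAt_const w y)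
  have hdη : ∀ v w : E₁ × E₂, HasFDerivAt (fun y' : E₁ × E₂ => η y'.2 v.2 * η y'.2 w.2) _ y :=
    fun v w => (hη'.clm_apply (hasFDerivAt_const v.2 y)).mul
      (hη'.clm_apply (hasFDerivAt_const w.2 y))
  -- Testing against the vertical vector `(0, u)` removes the `G₁` term.
  have k1 : ∀ a b : E₁ × E₂, fderiv ℝ G y a b (0, u) =
      fderiv ℝ η y.2 a.2 b.2 * η y.2 u + η y.2 b.2 * fderiv ℝ η y.2 a.2 u := by
    intro a b
    have e : (fun y' => G y' b (0, u)) =ᶠ[nhds y] fun y' => η y'.2 b.2 * η y'.2 (0, u).2 :=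
      Filter.eventually_of_mem hO fun y' hy' => by simp [hsplit y' hy']
    have := DFunLike.congr_fun ((hd b (0, u)).unique ((hdη b (0, u)).congr_of_eventuallyEq e)) a
    simp at this
    rw [this]; ring
  -- Along `(0, u)` the first component of the point stays fixed, so the `G₁` term is constant and
  -- no differentiability of `G₁` is needed.
  have k2 : fderiv ℝ G y (0, u) v w =
      fderiv ℝ η y.2 u v.2 * η y.2 w.2 + η y.2 v.2 * fderiv ℝ η y.2 u w.2 := by
    have hline : HasDerivAt (fun s : ℝ => y + s • ((0, u) : E₁ × E₂)) (0, u) 0 := by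
      simpa using ((hasDerivAt_id (0 : ℝ)).smul_const ((0, u) : E₁ × E₂)).const_add y
    have h0 : y = y + (0 : ℝ) • ((0, u) : E₁ × E₂) := by simp
    have a1 := ((hd v w).congr_fderiv rfl)
    rw [h0] at a1
    have a1 := a1.comp_hasDerivAt (0 : ℝ) hline
    have a2 := hdη v w
    rw [h0] at a2
    have a2 := a2.comp_hasDerivAt (0 : ℝ) hline
    have hev : ∀ᶠ s in nhds (0 : ℝ), y + s • ((0, u) : E₁ × E₂) ∈ O := by
      apply hline.continuousAt.eventually_mem
      rw [← h0]; exact hO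
    have e : (fun s : ℝ => G (y + s • ((0, u) : E₁ × E₂)) v w) =ᶠ[nhds 0] fun s =>
        G₁ y.1 v.1 w.1 + η (y + s • ((0, u) : E₁ × E₂)).2 v.2 *
          η (y + s • ((0, u) : E₁ × E₂)).2 w.2 :=
      hev.mono fun s hs => by simp only [hsplit _ hs]; simp
    have := a1.unique ((a2.const_add (G₁ y.1 v.1 w.1)).congr_of_eventuallyEq e)
    simp at this
    rw [this]; ring
  have h1 := hG.apply_christoffel hy v w (0, u)
  rw [hsplit y hy, christoffelFirst_apply, k1, k1, k2, hclosed u v.2, hclosed u w.2,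
    hclosed w.2 v.2] at h1
  simp only [map_zero, zero_add] at h1
  have h2 : η y.2 (christoffel G y v w).2 * η y.2 u = fderiv ℝ η y.2 v.2 w.2 * η y.2 u := by
    rw [h1]; ring
  exact mul_right_cancel₀ hu h2

end LocalMetric

/-! ### Covariant derivatives along a map -/

section AlongMap

variable {E : Type*} [NormedAddCommGroup E] [NormedSpace ℝ E]
  {F : Type*} [NormedAddCommGroup F] [NormedSpace ℝ F]

/-- The covariant derivative in the direction `e` of a vector field `V` along the map `x`. -/
def covAlong (G : E → E →L[ℝ] E →L[ℝ] ℝ) (x : F → E) (e : F) (V : F → E) (q : F) : E :=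
  fderiv ℝ V q e + christoffel G (x q) (fderiv ℝ x q e) (V q)

lemma contDiffOn_fderiv_apply {f : F → E} {O : Set F} (hO : IsOpen O) (hf : ContDiffOn ℝ ∞ f O)
    (e : F) : ContDiffOn ℝ ∞ (fun q => fderiv ℝ f q e) O :=
  (hf.fderiv_of_isOpen hO (by simp)).clm_apply contDiffOn_const

lemma fderiv_fderiv_apply_comm {f : F → E} {O : Set F} (hO : IsOpen O) (hf : ContDiffOn ℝ ∞ f O)
    {q : F} (hq : q ∈ O) (e₁ e₂ : F) :
    fderiv ℝ (fun q => fderiv ℝ f q e₁) q e₂ = fderiv ℝ (fun q => fderiv ℝ f q e₂) q e₁ := by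
  have hf' := hf.contDiffAt (hO.mem_nhds hq)
  have hd : DifferentiableAt ℝ (fderiv ℝ f) q :=
    (hf'.fderiv_right (m := 1) (by norm_cast)).differentiableAt (by simp)
  rw [fderiv_clm_apply hd (differentiableAt_const _), fderiv_clm_apply hd (differentiableAt_const _)]
  have := hf'.isSymmSndFDerivAt (by simp; norm_cast)
  simpa using this e₂ e₁

lemma differentiableAt_of_contDiffOn {f : F → E} {Ω : Set F} (hΩ : IsOpen Ω)
    (hf : ContDiffOn ℝ ∞ f Ω) {q : F} (hq : q ∈ Ω) : DifferentiableAt ℝ f q :=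
  (hf.contDiffAt (hΩ.mem_nhds hq)).differentiableAt (by simp)

lemma covAlong_smul {G : E → E →L[ℝ] E →L[ℝ] ℝ} {x : F → E} {Ω : Set F}
    (hΩ : IsOpen Ω) {f : F → ℝ} {V : F → E} (hf : ContDiffOn ℝ ∞ f Ω) (hV : ContDiffOn ℝ ∞ V Ω)
    {q : F} (hq : q ∈ Ω) (e : F) :
    covAlong G x e (fun q => f q • V q) q = fderiv ℝ f q e • V q + f q • covAlong G x e V q := by
  rw [covAlong, covAlong, fderiv_fun_smul (differentiableAt_of_contDiffOn hΩ hf hq)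
    (differentiableAt_of_contDiffOn hΩ hV hq)]
  rw [← christoffelCLM_apply, ← christoffelCLM_apply, map_smul, smul_add]
  simp
  abel

lemma covAlong_add {G : E → E →L[ℝ] E →L[ℝ] ℝ} {x : F → E} {Ω : Set F}
    (hΩ : IsOpen Ω) {V W : F → E} (hV : ContDiffOn ℝ ∞ V Ω) (hW : ContDiffOn ℝ ∞ W Ω)
    {q : F} (hq : q ∈ Ω) (e : F) :
    covAlong G x e (fun q => V q + W q) q = covAlong G x e V q + covAlong G x e W q := by
  rw [covAlong, covAlong, covAlong, fderiv_fun_add (differentiableAt_of_contDiffOn hΩ hV hq)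
    (differentiableAt_of_contDiffOn hΩ hW hq)]
  rw [← christoffelCLM_apply, ← christoffelCLM_apply, ← christoffelCLM_apply, map_add]
  simp
  abel

lemma covAlong_congr {G : E → E →L[ℝ] E →L[ℝ] ℝ} {x : F → E} {Ω : Set F}
    (hΩ : IsOpen Ω) {V W : F → E} (h : Set.EqOn V W Ω) {q : F} (hq : q ∈ Ω) (e : F) :
    covAlong G x e V q = covAlong G x e W q := by
  rw [covAlong, covAlong, (h.eventuallyEq_of_mem (hΩ.mem_nhds hq)).fderiv_eq, h hq]

variable [FiniteDimensional ℝ E] {G : E → E →L[ℝ] E →L[ℝ] ℝ} {O : Set E} (hG : IsLocalMetric G O)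
  {x : F → E} {Ω : Set F} (hΩ : IsOpen Ω) (hx : ContDiffOn ℝ ∞ x Ω) (hxO : Set.MapsTo x Ω O)

include hG hΩ hx hxO

lemma contDiffOn_covAlong (e : F) {V : F → E} (hV : ContDiffOn ℝ ∞ V Ω) :
    ContDiffOn ℝ ∞ (covAlong G x e V) Ω := by
  have h : ContDiffOn ℝ ∞ (fun q => fderiv ℝ V q e +
      christoffelCLM G (x q) (fderiv ℝ x q e) (V q)) Ω :=
    (contDiffOn_fderiv_apply hΩ hV e).add
      (((hG.contDiffOn_christoffelCLM.comp hx hxO).clm_apply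
        (contDiffOn_fderiv_apply hΩ hx e)).clm_apply hV)
  simp only [christoffelCLM_apply] at h
  exact h

/-- Mixed partial derivatives commute and the connection is torsion-free. -/
lemma covAlong_fderiv_comm {q : F} (hq : q ∈ Ω) (e₁ e₂ : F) :
    covAlong G x e₁ (fun q => fderiv ℝ x q e₂) q = covAlong G x e₂ (fun q => fderiv ℝ x q e₁) q := by
  rw [covAlong, covAlong, fderiv_fderiv_apply_comm hΩ hx hq, hG.christoffel_symm (hxO hq)]

lemma fderiv_metric_apply {V W : F → E} (hV : ContDiffOn ℝ ∞ V Ω) (hW : ContDiffOn ℝ ∞ W Ω)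
    {q : F} (hq : q ∈ Ω) (e : F) :
    fderiv ℝ (fun q => G (x q) (V q) (W q)) q e =
      G (x q) (covAlong G x e V q) (W q) + G (x q) (V q) (covAlong G x e W q) := by
  have hdx := (differentiableAt_of_contDiffOn hΩ hx hq).hasFDerivAt
  have hdV := (differentiableAt_of_contDiffOn hΩ hV hq).hasFDerivAt
  have hdW := (differentiableAt_of_contDiffOn hΩ hW hq).hasFDerivAt
  have h : HasFDerivAt (fun q => G (x q) (V q) (W q)) _ q :=
    (((hG.differentiableAt (hxO hq)).hasFDerivAt.comp q hdx).clm_apply hdV).clm_apply hdW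
  rw [h.fderiv]
  simp [covAlong, hG.fderiv_eq (hxO hq)]
  ring

-- The use of parallelism: the form passes through the covariant derivative, so the evolution of
-- θ(T) contains no derivative of θ.
omit hG [FiniteDimensional ℝ E] in
lemma fderiv_parallel_apply {η : E → E →L[ℝ] ℝ} (hη : ∀ y ∈ O, DifferentiableAt ℝ η y)
    (hpar : ∀ y ∈ O, ∀ v w, η y (christoffel G y v w) = fderiv ℝ η y v w)
    {V : F → E} (hV : ContDiffOn ℝ ∞ V Ω) {q : F} (hq : q ∈ Ω) (e : F) :
    fderiv ℝ (fun q => η (x q) (V q)) q e = η (x q) (covAlong G x e V q) := by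
  have hdx := (differentiableAt_of_contDiffOn hΩ hx hq).hasFDerivAt
  have hdV := (differentiableAt_of_contDiffOn hΩ hV hq).hasFDerivAt
  have h : HasFDerivAt (fun q => η (x q) (V q)) _ q :=
    ((hη _ (hxO hq)).hasFDerivAt.comp q hdx).clm_apply hdV
  rw [h.fderiv]
  simp [covAlong, hpar _ (hxO hq)]

/-- The directions are constant, so there is no bracket term. The terms of the expansion `h` that
are symmetric in e₁ and e₂ cancel; the derivative of Γ and its quadratic terms make up the
curvature. -/
lemma covAlong_covAlong_sub {V : F → E} (hV : ContDiffOn ℝ ∞ V Ω) {q : F} (hq : q ∈ Ω)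
    (e₁ e₂ : F) :
    covAlong G x e₁ (covAlong G x e₂ V) q - covAlong G x e₂ (covAlong G x e₁ V) q =
      riemannCurvature G (x q) (fderiv ℝ x q e₁) (fderiv ℝ x q e₂) (V q) := by
  have hΓ : DifferentiableAt ℝ (christoffelCLM G) (x q) :=
    (hG.contDiffOn_christoffelCLM.contDiffAt (hG.isOpen.mem_nhds (hxO hq))).differentiableAt
      (by simp)
  have hdx := (differentiableAt_of_contDiffOn hΩ hx hq).hasFDerivAt
  have hdV := (differentiableAt_of_contDiffOn hΩ hV hq).hasFDerivAt
  have h : ∀ e₁ e₂, covAlong G x e₁ (covAlong G x e₂ V) q =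
      fderiv ℝ (fun q => fderiv ℝ V q e₂) q e₁ +
      (fderiv ℝ (christoffelCLM G) (x q) (fderiv ℝ x q e₁) (fderiv ℝ x q e₂) (V q) +
      christoffelCLM G (x q) (fderiv ℝ (fun q => fderiv ℝ x q e₂) q e₁) (V q) +
      christoffelCLM G (x q) (fderiv ℝ x q e₂) (fderiv ℝ V q e₁)) +
      (christoffelCLM G (x q) (fderiv ℝ x q e₁) (fderiv ℝ V q e₂) +
      christoffelCLM G (x q) (fderiv ℝ x q e₁)
        (christoffelCLM G (x q) (fderiv ℝ x q e₂) (V q))) := by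
    intro e₁ e₂
    have hV2 := (differentiableAt_of_contDiffOn hΩ (contDiffOn_fderiv_apply hΩ hV e₂)
      hq).hasFDerivAt
    have hx2 := (differentiableAt_of_contDiffOn hΩ (contDiffOn_fderiv_apply hΩ hx e₂)
      hq).hasFDerivAt
    have hd : HasFDerivAt (fun q => fderiv ℝ V q e₂ +
        christoffelCLM G (x q) (fderiv ℝ x q e₂) (V q)) _ q :=
      hV2.add (((hΓ.hasFDerivAt.comp q hdx).clm_apply hx2).clm_apply hdV)
    have heq : covAlong G x e₂ V = fun q => fderiv ℝ V q e₂ +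
        christoffelCLM G (x q) (fderiv ℝ x q e₂) (V q) := by
      ext q; rw [covAlong, christoffelCLM_apply]
    rw [covAlong, heq, hd.fderiv, ← christoffelCLM_apply]
    simp
    abel
  have hR : ∀ a b c, fderiv ℝ (fun y' => christoffel G y' b c) (x q) a =
      fderiv ℝ (christoffelCLM G) (x q) a b c := by
    intro a b c
    have hd : HasFDerivAt (fun y' => christoffelCLM G y' b c) _ (x q) :=
      (hΓ.hasFDerivAt.clm_apply (hasFDerivAt_const b _)).clm_apply (hasFDerivAt_const c _)
    simp only [← christoffelCLM_apply]
    rw [hd.fderiv]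
    simp
  rw [h, h, riemannCurvature, hR, hR, fderiv_fderiv_apply_comm hΩ hV hq e₂ e₁,
    fderiv_fderiv_apply_comm hΩ hx hq e₂ e₁]
  simp only [← christoffelCLM_apply]
  abel

end AlongMap

section Curvature

variable {E : Type*} [NormedAddCommGroup E] [NormedSpace ℝ E] [FiniteDimensional ℝ E]
  {G : E → E →L[ℝ] E →L[ℝ] ℝ} {O : Set E}

/-- Homogeneity in this slot lets the coordinate velocity be replaced by speed times T in the
commutator of the time and space derivatives. -/
lemma IsLocalMetric.riemannCurvature_smul_right (hG : IsLocalMetric G O) {y : E} (hy : y ∈ O)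
    (r : ℝ) (a b c : E) :
    riemannCurvature G y a (r • b) c = r • riemannCurvature G y a b c := by
  have hΓ : DifferentiableAt ℝ (christoffelCLM G) y :=
    (hG.contDiffOn_christoffelCLM.contDiffAt (hG.isOpen.mem_nhds hy)).differentiableAt (by simp)
  have hR : ∀ a b c, fderiv ℝ (fun y' => christoffelCLM G y' b c) y a =
      fderiv ℝ (christoffelCLM G) y a b c := by
    intro a b c
    have hd : HasFDerivAt (fun y' => christoffelCLM G y' b c) _ y :=
      (hΓ.hasFDerivAt.clm_apply (hasFDerivAt_const b _)).clm_apply (hasFDerivAt_const c _)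
    rw [hd.fderiv]
    simp
  simp only [riemannCurvature, ← christoffelCLM_apply, hR]
  simp [smul_sub, smul_add]

end Curvature

/-! ### Curve shortening flow in a chart -/

section MaxPrinciple

/-- Derivatives of `w` at a point which is a maximum in space and at which `w` was not larger
before; the first space derivative is given in the form `S * h` with `0 < S`. -/
lemma derivatives_at_first_maximum {w h S : ℝ × ℝ → ℝ} {Ω : Set (ℝ × ℝ)} (hΩ : IsOpen Ω)
    (hw : ContDiffOn ℝ ∞ w Ω) (hh : ContDiffOn ℝ ∞ h Ω) (hS : ContDiffOn ℝ ∞ S Ω)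
    {a t : ℝ} (hq : (a, t) ∈ Ω) (hpos : 0 < S (a, t))
    (hwb : ∀ q ∈ Ω, fderiv ℝ w q (1, 0) = S q * h q)
    (hspace : ∀ b, (b, t) ∈ Ω → w (b, t) ≤ w (a, t))
    (htime : ∀ s < t, (a, s) ∈ Ω → w (a, s) ≤ w (a, t)) :
    h (a, t) = 0 ∧ fderiv ℝ h (a, t) (1, 0) ≤ 0 ∧ 0 ≤ fderiv ℝ w (a, t) (0, 1) := by
  have hlineb : ∀ b : ℝ, HasDerivAt (fun b : ℝ => (b, t)) ((1, 0) : ℝ × ℝ) b := fun b =>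
    (hasDerivAt_id b).prodMk (hasDerivAt_const b t)
  have hlinet : HasDerivAt (fun s : ℝ => (a, s)) ((0, 1) : ℝ × ℝ) t :=
    (hasDerivAt_const t a).prodMk (hasDerivAt_id t)
  have hevb : ∀ᶠ b in nhds a, (b, t) ∈ Ω :=
    (hlineb a).continuousAt.eventually_mem (hΩ.mem_nhds hq)
  have hevt : ∀ᶠ s in nhds t, (a, s) ∈ Ω :=
    hlinet.continuousAt.eventually_mem (hΩ.mem_nhds hq)
  have hderiv : ∀ {f : ℝ × ℝ → ℝ}, ContDiffOn ℝ ∞ f Ω → ∀ b, (b, t) ∈ Ω →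
      HasDerivAt (fun b => f (b, t)) (fderiv ℝ f (b, t) (1, 0)) b := fun hf b hb =>
    (differentiableAt_of_contDiffOn hΩ hf hb).hasFDerivAt.comp_hasDerivAt b (hlineb b)
  have hmax : IsLocalMax (fun b => w (b, t)) a := hevb.mono hspace
  have h0 : h (a, t) = 0 := by
    have := hmax.hasDerivAt_eq_zero (hderiv hw a hq)
    rw [hwb _ hq] at this
    exact (mul_eq_zero.1 this).resolve_left hpos.ne'
  refine ⟨h0, ?_, ?_⟩
  -- A positive second derivative would make the maximum a local minimum too, so the function would
  -- be locally constant and its second derivative zero.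
  · by_contra! hneg
    have hd1 : deriv (fun b => w (b, t)) =ᶠ[nhds a] fun b => S (b, t) * h (b, t) :=
      hevb.mono fun b hb => by rw [(hderiv hw b hb).deriv, hwb _ hb]
    -- The derivative of `S` drops out because `h` vanishes at the point.
    have hd2 : deriv (deriv fun b => w (b, t)) a = S (a, t) * fderiv ℝ h (a, t) (1, 0) := by
      rw [hd1.deriv_eq, ((hderiv hS a hq).fun_mul (hderiv hh a hq)).deriv, h0]
      simp
    have hmin := isLocalMin_of_deriv_deriv_pos (by rw [hd2]; positivity)
      (by rw [hd1.eq_of_nhds, h0, mul_zero]) (hderiv hw a hq).continuousAt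
    have hconst : (fun b => w (b, t)) =ᶠ[nhds a] fun _ => w (a, t) := by
      filter_upwards [hmax, hmin] with b h1 h2 using le_antisymm h1 h2
    have h3 : deriv (fun b => w (b, t)) =ᶠ[nhds a] fun _ => 0 :=
      hconst.deriv.trans (by simp)
    rw [h3.deriv_eq, deriv_const] at hd2
    exact (mul_pos hpos hneg).ne hd2
  -- Only earlier times are controlled, so the sign is read off from left difference quotients.
  · have hd : HasDerivAt (fun s => w (a, s)) (fderiv ℝ w (a, t) (0, 1)) t :=
      (differentiableAt_of_contDiffOn hΩ hw hq).hasFDerivAt.comp_hasDerivAt t hlinet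
    have hslope := hd.hasDerivWithinAt (s := Set.Iio t)
    rw [hasDerivWithinAt_iff_tendsto_slope' (by simp)] at hslope
    refine ge_of_tendsto hslope ?_
    filter_upwards [self_mem_nhdsWithin, mem_nhdsWithin_of_mem_nhds hevt] with s hs hsΩ
    rw [slope_def_field]
    exact div_nonneg_of_nonpos (by linarith [htime s hs hsΩ]) (by linarith [Set.mem_Iio.1 hs])

/-- A function on `ℝ × [0, τ)` that is periodic in space and negative at time `0` stays negative
if it cannot reach `0` for the first time. -/
lemma neg_of_no_first_zero {S : Set ℝ} (hS : ∀ t ∈ S, 0 ≤ t ∧ Set.Icc 0 t ⊆ S) {w : ℝ → ℝ → ℝ}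
    (hw : ContinuousOn (fun q : ℝ × ℝ => w q.1 q.2) (Set.univ ×ˢ S)) {c : ℝ} (hc : 0 < c)
    (hper : ∀ t ∈ S, Function.Periodic (fun a => w a t) c) (h0 : ∀ a, w a 0 < 0)
    (hstep : ∀ a, ∀ t ∈ S, 0 < t → w a t = 0 → (∀ b, w b t ≤ 0) →
      (∀ s, 0 ≤ s → s < t → w a s < 0) → False) :
    ∀ t ∈ S, ∀ a, w a t < 0 := by
  intro t ht a
  by_contra! hcon
  have hred : ∀ s ∈ S, ∀ b, ∃ b' ∈ Set.Icc 0 c, w b s = w b' s := by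
    intro s hs b
    obtain ⟨b', hb', e⟩ := (hper s hs).exists_mem_Ico₀ hc b
    exact ⟨b', Set.Ico_subset_Icc_self hb', e⟩
  have hsub : Set.Icc 0 c ×ˢ Set.Icc 0 t ⊆ Set.univ ×ˢ S :=
    Set.prod_mono (Set.subset_univ _) (hS t ht).2
  have hcomp : IsCompact ((Set.Icc 0 c ×ˢ Set.Icc 0 t) ∩
      (fun q : ℝ × ℝ => w q.1 q.2) ⁻¹' Set.Ici 0) :=
    (isCompact_Icc.prod isCompact_Icc).of_isClosed_subset
      ((hw.mono hsub).preimage_isClosed_of_isClosed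
        (isClosed_Icc.prod isClosed_Icc) isClosed_Ici) Set.inter_subset_left
  have hne : ((Set.Icc 0 c ×ˢ Set.Icc 0 t) ∩
      (fun q : ℝ × ℝ => w q.1 q.2) ⁻¹' Set.Ici 0).Nonempty := by
    obtain ⟨a', ha', e⟩ := hred t ht a
    exact ⟨(a', t), ⟨ha', (hS t ht).1, le_rfl⟩, by simpa [← e] using hcon⟩
  -- The first time at which `w` is nonnegative somewhere: the time coordinate attains its minimum
  -- on a compact set.
  obtain ⟨⟨a₁, t₁⟩, ⟨⟨ha₁, ht₁⟩, hw₁⟩, hmin⟩ := hcomp.exists_isMinOn hne continuousOn_snd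
  simp only [Set.mem_preimage, Set.mem_Ici] at hw₁ ht₁
  have hbefore : ∀ b s, 0 ≤ s → s < t₁ → w b s < 0 := by
    intro b s hs hst
    by_contra! hb
    have hsS : s ∈ Set.Icc 0 t := ⟨hs, hst.le.trans ht₁.2⟩
    obtain ⟨b', hb', e⟩ := hred s ((hS t ht).2 hsS) b
    have := hmin (show ((b', s) : ℝ × ℝ) ∈ _ from ⟨⟨hb', hsS⟩, by simpa [← e] using hb⟩)
    exact absurd hst (not_lt.2 this)
  have ht₁S : t₁ ∈ S := (hS t ht).2 ht₁
  have hpos : 0 < t₁ := by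
    rcases ht₁.1.eq_or_lt with h | h
    · rw [← h] at hw₁
      exact absurd hw₁ (not_le.2 (h0 a₁))
    · exact h
  -- The values at `t₁` are limits of negative values at earlier times.
  have hle : ∀ b, w b t₁ ≤ 0 := by
    intro b
    have hcont : ContinuousWithinAt (fun s => w b s) (Set.Icc 0 t₁) t₁ := by
      have h1 : ContinuousWithinAt (fun q : ℝ × ℝ => w q.1 q.2) (Set.univ ×ˢ S) (b, t₁) :=
        hw _ ⟨Set.mem_univ _, ht₁S⟩
      exact h1.comp (f := fun s => (b, s)) (by fun_prop)
        fun s hs => ⟨Set.mem_univ _, (hS t₁ ht₁S).2 hs⟩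
    have hcont' : Filter.Tendsto (fun s => w b s) (nhdsWithin t₁ (Set.Ico 0 t₁))
        (nhds (w b t₁)) := hcont.mono Set.Ico_subset_Icc_self
    have : (nhdsWithin t₁ (Set.Ico 0 t₁)).NeBot := by
      rw [← mem_closure_iff_nhdsWithin_neBot, closure_Ico hpos.ne]
      exact ⟨hpos.le, le_rfl⟩
    refine le_of_tendsto hcont' ?_
    filter_upwards [self_mem_nhdsWithin] with s hs using (hbefore b s hs.1 hs.2).le
  exact hstep a₁ t₁ ht₁S hpos (le_antisymm (hle a₁) hw₁) hle fun s hs hst => hbefore a₁ s hs hst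

end MaxPrinciple

/-! ### Curve shortening flow in a single chart. -/

section ChartFlow

variable {E : Type*} [NormedAddCommGroup E] [NormedSpace ℝ E]

section Defs

variable (G : E → E →L[ℝ] E →L[ℝ] ℝ) (x : ℝ × ℝ → E)

/-- The speed `|∂x/∂b|` of a family of curves `x (b, t)`. -/
def chartSpeed (q : ℝ × ℝ) : ℝ := √(G (x q) (fderiv ℝ x q (1, 0)) (fderiv ℝ x q (1, 0)))

/-- The unit tangent field of a family of curves. -/
def chartTangent (q : ℝ × ℝ) : E := (chartSpeed G x q)⁻¹ • fderiv ℝ x q (1, 0)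

/-- The time derivative of a family of curves. -/
def chartVelocity (q : ℝ × ℝ) : E := fderiv ℝ x q (0, 1)

/-- The derivative by arc length of the time derivative of a family of curves. -/
def chartVelocityDeriv (q : ℝ × ℝ) : E :=
  (chartSpeed G x q)⁻¹ • covAlong G x (1, 0) (chartVelocity x) q

end Defs

/-- The family of curves `x` is a curve shortening flow with respect to the metric `G`, and
`η` is a parallel one-form. -/
structure IsChartFlow (G : E → E →L[ℝ] E →L[ℝ] ℝ) (O : Set E) (η : E → E →L[ℝ] ℝ)
    (x : ℝ × ℝ → E) (Ω : Set (ℝ × ℝ)) : Prop where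
  metric : IsLocalMetric G O
  form_smooth : ContDiffOn ℝ ∞ η O
  parallel : ∀ y ∈ O, ∀ v w, η y (christoffel G y v w) = fderiv ℝ η y v w
  isOpen : IsOpen Ω
  smooth : ContDiffOn ℝ ∞ x Ω
  mapsTo : Set.MapsTo x Ω O
  immersed : ∀ q ∈ Ω, fderiv ℝ x q (1, 0) ≠ 0
  evolution : ∀ q ∈ Ω, chartVelocity x q =
    (chartSpeed G x q)⁻¹ • covAlong G x (1, 0) (chartTangent G x) q

namespace IsChartFlow

variable {G : E → E →L[ℝ] E →L[ℝ] ℝ} {O : Set E} {η : E → E →L[ℝ] ℝ} {x : ℝ × ℝ → E}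
  {Ω : Set (ℝ × ℝ)} (h : IsChartFlow G O η x Ω) {q : ℝ × ℝ}
include h

lemma metric_nonneg (hq : q ∈ Ω) (v : E) : 0 ≤ G (x q) v v := by
  rcases eq_or_ne v 0 with rfl | hv
  · simp
  · exact (h.metric.pos _ (h.mapsTo hq) v hv).le

lemma metric_symm (hq : q ∈ Ω) (v w : E) : G (x q) v w = G (x q) w v :=
  h.metric.symm _ (h.mapsTo hq) v w

lemma speed_pos (hq : q ∈ Ω) : 0 < chartSpeed G x q :=
  Real.sqrt_pos.2 (h.metric.pos _ (h.mapsTo hq) _ (h.immersed q hq))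

lemma speed_sq (hq : q ∈ Ω) :
    G (x q) (fderiv ℝ x q (1, 0)) (fderiv ℝ x q (1, 0)) = chartSpeed G x q ^ 2 :=
  (Real.sq_sqrt (h.metric_nonneg hq _)).symm

lemma contDiffOn_metric {V W : ℝ × ℝ → E} (hV : ContDiffOn ℝ ∞ V Ω) (hW : ContDiffOn ℝ ∞ W Ω) :
    ContDiffOn ℝ ∞ (fun q => G (x q) (V q) (W q)) Ω :=
  ((h.metric.smooth.comp h.smooth h.mapsTo).clm_apply hV).clm_apply hW

lemma contDiffOn_form {V : ℝ × ℝ → E} (hV : ContDiffOn ℝ ∞ V Ω) :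
    ContDiffOn ℝ ∞ (fun q => η (x q) (V q)) Ω :=
  (h.form_smooth.comp h.smooth h.mapsTo).clm_apply hV

lemma contDiffOn_fderiv (e : ℝ × ℝ) : ContDiffOn ℝ ∞ (fun q => fderiv ℝ x q e) Ω :=
  contDiffOn_fderiv_apply h.isOpen h.smooth e

lemma contDiffOn_velocity : ContDiffOn ℝ ∞ (chartVelocity x) Ω := h.contDiffOn_fderiv (0, 1)

lemma contDiffOn_speed : ContDiffOn ℝ ∞ (chartSpeed G x) Ω :=
  (h.contDiffOn_metric (h.contDiffOn_fderiv (1, 0)) (h.contDiffOn_fderiv (1, 0))).sqrt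
    fun _ hq => (h.metric.pos _ (h.mapsTo hq) _ (h.immersed _ hq)).ne'

lemma contDiffOn_speed_inv : ContDiffOn ℝ ∞ (fun q => (chartSpeed G x q)⁻¹) Ω :=
  h.contDiffOn_speed.inv fun _ hq => (h.speed_pos hq).ne'

lemma contDiffOn_tangent : ContDiffOn ℝ ∞ (chartTangent G x) Ω :=
  h.contDiffOn_speed_inv.smul (h.contDiffOn_fderiv (1, 0))

lemma fderiv_eq_smul_tangent (hq : q ∈ Ω) :
    fderiv ℝ x q (1, 0) = chartSpeed G x q • chartTangent G x q := by
  rw [chartTangent, smul_inv_smul₀ (h.speed_pos hq).ne']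

lemma metric_tangent_tangent (hq : q ∈ Ω) :
    G (x q) (chartTangent G x q) (chartTangent G x q) = 1 := by
  have := (h.speed_pos hq).ne'
  simp only [chartTangent, map_smul, smul_apply, smul_eq_mul, h.speed_sq hq]
  field_simp

/-! ### Evolution equations of speed, unit tangent and curvature vector. -/

variable [FiniteDimensional ℝ E]

lemma contDiffOn_cov {V : ℝ × ℝ → E} (hV : ContDiffOn ℝ ∞ V Ω) (e : ℝ × ℝ) :
    ContDiffOn ℝ ∞ (covAlong G x e V) Ω :=
  contDiffOn_covAlong h.metric h.isOpen h.smooth h.mapsTo e hV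

lemma fderiv_metric {V W : ℝ × ℝ → E} (hV : ContDiffOn ℝ ∞ V Ω) (hW : ContDiffOn ℝ ∞ W Ω)
    (hq : q ∈ Ω) (e : ℝ × ℝ) : fderiv ℝ (fun q => G (x q) (V q) (W q)) q e =
      G (x q) (covAlong G x e V q) (W q) + G (x q) (V q) (covAlong G x e W q) :=
  fderiv_metric_apply h.metric h.isOpen h.smooth h.mapsTo hV hW hq e

omit [FiniteDimensional ℝ E] in
lemma fderiv_form {V : ℝ × ℝ → E} (hV : ContDiffOn ℝ ∞ V Ω) (hq : q ∈ Ω) (e : ℝ × ℝ) :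
    fderiv ℝ (fun q => η (x q) (V q)) q e = η (x q) (covAlong G x e V q) :=
  fderiv_parallel_apply h.isOpen h.smooth h.mapsTo
    (fun _ hy => (h.form_smooth.contDiffAt (h.metric.isOpen.mem_nhds hy)).differentiableAt
      (by simp)) h.parallel hV hq e

lemma contDiffOn_velocityDeriv : ContDiffOn ℝ ∞ (chartVelocityDeriv G x) Ω :=
  h.contDiffOn_speed_inv.smul (h.contDiffOn_cov h.contDiffOn_velocity (1, 0))

omit [FiniteDimensional ℝ E] in
lemma cov_space_tangent (hq : q ∈ Ω) :
    covAlong G x (1, 0) (chartTangent G x) q = chartSpeed G x q • chartVelocity x q := by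
  rw [h.evolution q hq, smul_inv_smul₀ (h.speed_pos hq).ne']

omit [FiniteDimensional ℝ E] in
lemma cov_space_velocity (hq : q ∈ Ω) :
    covAlong G x (1, 0) (chartVelocity x) q = chartSpeed G x q • chartVelocityDeriv G x q := by
  rw [chartVelocityDeriv, smul_inv_smul₀ (h.speed_pos hq).ne']

/-- Differentiate |T|² = 1 along the curve. -/
lemma metric_velocity_tangent (hq : q ∈ Ω) :
    G (x q) (chartVelocity x q) (chartTangent G x q) = 0 := by
  have h1 := h.fderiv_metric h.contDiffOn_tangent h.contDiffOn_tangent hq (1, 0)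
  have h2 : (fun q => G (x q) (chartTangent G x q) (chartTangent G x q)) =ᶠ[nhds q]
      fun _ => 1 := Filter.eventually_of_mem (h.isOpen.mem_nhds hq)
    fun q hq => h.metric_tangent_tangent hq
  rw [h2.fderiv_eq, h.metric_symm hq (chartTangent G x q), h.cov_space_tangent hq] at h1
  simp at h1
  have h3 := (h.speed_pos hq).ne'
  apply mul_left_cancel₀ h3
  linarith

/-- Differentiate ⟨K,T⟩ = 0 along the curve. -/
lemma metric_velocityDeriv_tangent (hq : q ∈ Ω) :
    G (x q) (chartVelocityDeriv G x q) (chartTangent G x q) =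
      -G (x q) (chartVelocity x q) (chartVelocity x q) := by
  have h1 := h.fderiv_metric h.contDiffOn_velocity h.contDiffOn_tangent hq (1, 0)
  have h2 : (fun q => G (x q) (chartVelocity x q) (chartTangent G x q)) =ᶠ[nhds q]
      fun _ => 0 := Filter.eventually_of_mem (h.isOpen.mem_nhds hq)
    fun q hq => h.metric_velocity_tangent hq
  rw [h2.fderiv_eq, h.cov_space_tangent hq, h.cov_space_velocity hq] at h1
  simp at h1
  have h3 := (h.speed_pos hq).ne'
  apply mul_left_cancel₀ h3
  linarith

lemma cov_time_fderiv (hq : q ∈ Ω) : covAlong G x (0, 1) (fun q => fderiv ℝ x q (1, 0)) q =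
    chartSpeed G x q • chartVelocityDeriv G x q := by
  rw [covAlong_fderiv_comm h.metric h.isOpen h.smooth h.mapsTo hq]
  exact h.cov_space_velocity hq

/-- The time derivative of the squared speed S² is 2S²⟨P,T⟩, and ⟨P,T⟩ = -|K|². -/
lemma fderiv_time_speed (hq : q ∈ Ω) : fderiv ℝ (chartSpeed G x) q (0, 1) =
    -(G (x q) (chartVelocity x q) (chartVelocity x q)) * chartSpeed G x q := by
  have h1 := h.fderiv_metric (h.contDiffOn_fderiv (1, 0)) (h.contDiffOn_fderiv (1, 0)) hq (0, 1)
  have h2 : (fun q => G (x q) (fderiv ℝ x q (1, 0)) (fderiv ℝ x q (1, 0))) =ᶠ[nhds q]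
      fun q => chartSpeed G x q ^ 2 := Filter.eventually_of_mem (h.isOpen.mem_nhds hq)
    fun q hq => h.speed_sq hq
  have h3 := (differentiableAt_of_contDiffOn h.isOpen h.contDiffOn_speed hq).hasFDerivAt.pow 2
  rw [h2.fderiv_eq, h3.fderiv, h.cov_time_fderiv hq,
    h.metric_symm hq (fderiv ℝ x q (1, 0)), h.fderiv_eq_smul_tangent hq] at h1
  simp [h.metric_velocityDeriv_tangent hq] at h1
  have h4 := (h.speed_pos hq).ne'
  apply mul_left_cancel₀ h4
  linarith

/-- Apply D_t to ∂x/∂b = S T and divide by S; the multiple of T compensates for the shrinking of S.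
-/
lemma cov_time_tangent (hq : q ∈ Ω) : covAlong G x (0, 1) (chartTangent G x) q =
    chartVelocityDeriv G x q +
      G (x q) (chartVelocity x q) (chartVelocity x q) • chartTangent G x q := by
  have h1 : Set.EqOn (fun q => fderiv ℝ x q (1, 0))
      (fun q => chartSpeed G x q • chartTangent G x q) Ω := fun q hq => h.fderiv_eq_smul_tangent hq
  have h2 := covAlong_congr (G := G) (x := x) h.isOpen h1 hq (0, 1)
  rw [covAlong_smul h.isOpen h.contDiffOn_speed h.contDiffOn_tangent hq, h.cov_time_fderiv hq,
    h.fderiv_time_speed hq] at h2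
  have h4 := (h.speed_pos hq).ne'
  apply smul_right_injective E h4
  simp only [smul_add, h2]
  module

/-- Apply D_t to D_b T = S K and commute D_t with D_b, which produces the curvature term. One |K|²K
comes from ∂S/∂t, the other from D_b(|K|²T). -/
lemma cov_time_velocity (hq : q ∈ Ω) : covAlong G x (0, 1) (chartVelocity x) q =
    (chartSpeed G x q)⁻¹ • covAlong G x (1, 0) (chartVelocityDeriv G x) q +
    ((chartSpeed G x q)⁻¹ *
      fderiv ℝ (fun q => G (x q) (chartVelocity x q) (chartVelocity x q)) q (1, 0)) •
        chartTangent G x q +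
    (2 * G (x q) (chartVelocity x q) (chartVelocity x q)) • chartVelocity x q +
    riemannCurvature G (x q) (chartVelocity x q) (chartTangent G x q) (chartTangent G x q) := by
  have h1 : Set.EqOn (covAlong G x (1, 0) (chartTangent G x))
      (fun q => chartSpeed G x q • chartVelocity x q) Ω := fun q hq => h.cov_space_tangent hq
  have h2 := covAlong_congr (G := G) (x := x) h.isOpen h1 hq (0, 1)
  have h3 : Set.EqOn (covAlong G x (0, 1) (chartTangent G x)) (fun q => chartVelocityDeriv G x q +
      G (x q) (chartVelocity x q) (chartVelocity x q) • chartTangent G x q) Ω :=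
    fun q hq => h.cov_time_tangent hq
  have h4 := covAlong_congr (G := G) (x := x) h.isOpen h3 hq (1, 0)
  have hK := h.contDiffOn_metric h.contDiffOn_velocity h.contDiffOn_velocity
  rw [covAlong_add h.isOpen h.contDiffOn_velocityDeriv (hK.fun_smul h.contDiffOn_tangent) hq,
    covAlong_smul h.isOpen hK h.contDiffOn_tangent hq, h.cov_space_tangent hq] at h4
  have h5 := covAlong_covAlong_sub h.metric h.isOpen h.smooth h.mapsTo h.contDiffOn_tangent hq
    (0, 1) (1, 0)
  rw [h2, h4, covAlong_smul h.isOpen h.contDiffOn_speed h.contDiffOn_velocity hq,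
    h.fderiv_time_speed hq, h.fderiv_eq_smul_tangent hq,
    h.metric.riemannCurvature_smul_right (h.mapsTo hq), sub_eq_iff_eq_add] at h5
  have h6 := (h.speed_pos hq).ne'
  apply smul_right_injective E h6
  simp only [smul_add, smul_smul, mul_inv_cancel_left₀ h6, mul_inv_cancel₀ h6, one_smul]
  change _ = chartSpeed G x q • riemannCurvature G (x q) (fderiv ℝ x q (0, 1)) _ _ + _ at h5
  change _ = _ + chartSpeed G x q • riemannCurvature G (x q) (fderiv ℝ x q (0, 1)) _ _
  generalize riemannCurvature G (x q) (fderiv ℝ x q (0, 1)) _ _ = R at *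
  generalize covAlong G x (0, 1) (chartVelocity x) q = Z at *
  linear_combination (norm := module) h5

/-- `δ e⁻ᵗ - ⟨T, U⟩` cannot reach `0` for the first time. -/
lemma no_first_zero_form {a t δ : ℝ} (hq : (a, t) ∈ Ω) (hδ : 0 < δ)
    (h0 : δ * Real.exp (-t) - η (x (a, t)) (chartTangent G x (a, t)) = 0)
    (hspace : ∀ b, (b, t) ∈ Ω →
      δ * Real.exp (-t) - η (x (b, t)) (chartTangent G x (b, t)) ≤ 0)
    (htime : ∀ s < t, (a, s) ∈ Ω →
      δ * Real.exp (-s) - η (x (a, s)) (chartTangent G x (a, s)) ≤ 0) : False := by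
  have hexp : ∀ q : ℝ × ℝ, HasFDerivAt (fun q : ℝ × ℝ => δ * Real.exp (-q.2)) _ q := fun q =>
    (((hasFDerivAt_snd (𝕜 := ℝ) (p := q)).neg).exp).const_mul δ
  have hu := h.contDiffOn_form h.contDiffOn_tangent
  have hfd : ∀ q ∈ Ω, ∀ e, fderiv ℝ
      (fun q => δ * Real.exp (-q.2) - η (x q) (chartTangent G x q)) q e =
        -(δ * Real.exp (-q.2) * e.2) - η (x q) (covAlong G x e (chartTangent G x) q) := by
    intro q hq e
    rw [fderiv_fun_sub (hexp q).differentiableAt (differentiableAt_of_contDiffOn h.isOpen hu hq),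
      (hexp q).fderiv, sub_apply, h.fderiv_form h.contDiffOn_tangent hq]
    simp
    ring
  obtain ⟨-, h1, h2⟩ := derivatives_at_first_maximum h.isOpen
    (w := fun q => δ * Real.exp (-q.2) - η (x q) (chartTangent G x q))
    (h := fun q => -(η (x q) (chartVelocity x q))) (S := chartSpeed G x)
    (ContDiffOn.sub (by fun_prop) hu) (h.contDiffOn_form h.contDiffOn_velocity).neg
    h.contDiffOn_speed hq (h.speed_pos hq)
    (fun q hq => by rw [hfd q hq, h.cov_space_tangent hq]; simp)
    (fun b hb => (hspace b hb).trans h0.ge) (fun s hs hsΩ => (htime s hs hsΩ).trans h0.ge)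
  rw [hfd _ hq, h.cov_time_tangent hq, map_add, map_smul] at h2
  rw [fderiv_fun_neg, neg_apply, h.fderiv_form h.contDiffOn_velocity hq,
    h.cov_space_velocity hq, map_smul, smul_eq_mul] at h1
  -- The maximum in space gives θ(P) ≥ 0. The time derivative is -δe⁻ᵗ - θ(P) - |K|²θ(T), and the
  -- decay of e⁻ᵗ makes it strictly negative.
  have h3 : 0 ≤ η (x (a, t)) (chartVelocityDeriv G x (a, t)) :=
    nonneg_of_mul_nonneg_right (by linarith) (h.speed_pos hq)
  have h4 : 0 < δ * Real.exp (-t) := by positivity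
  have h5 := mul_nonneg (h.metric_nonneg hq (chartVelocity x (a, t))) h4.le
  have h6 : η (x (a, t)) (chartTangent G x (a, t)) = δ * Real.exp (-t) := by linarith
  rw [h6] at h2
  simp only [smul_eq_mul] at h2
  linarith

/-- `κ² - A e^{2 c t} ⟨T, U⟩²` cannot reach `0` for the first time if `c` is larger than the
sectional curvatures. -/
lemma no_first_zero_curvature {a t A c Ξ : ℝ} (hq : (a, t) ∈ Ω) (hA : 0 < A) (hc : Ξ < c)
    (hsec : ∀ v w, LinearIndependent ℝ ![v, w] →
      G (x (a, t)) (riemannCurvature G (x (a, t)) v w w) v /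
        (G (x (a, t)) v v * G (x (a, t)) w w - G (x (a, t)) v w ^ 2) ≤ Ξ)
    (hu : 0 < η (x (a, t)) (chartTangent G x (a, t)))
    {w : ℝ × ℝ → ℝ} (hw : ∀ q ∈ Ω, w q = G (x q) (chartVelocity x q) (chartVelocity x q) -
      A * Real.exp (2 * c * q.2) * η (x q) (chartTangent G x q) ^ 2)
    (h0 : w (a, t) = 0) (hspace : ∀ b, (b, t) ∈ Ω → w (b, t) ≤ 0)
    (htime : ∀ s < t, (a, s) ∈ Ω → w (a, s) ≤ 0) : False := by
  have hexp : ∀ q : ℝ × ℝ, HasFDerivAt (fun q : ℝ × ℝ => A * Real.exp (2 * c * q.2)) _ q :=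
    fun q => (((hasFDerivAt_snd (𝕜 := ℝ) (p := q)).const_mul (2 * c)).exp).const_mul A
  have hTs := h.contDiffOn_form h.contDiffOn_tangent
  have hKs := h.contDiffOn_metric h.contDiffOn_velocity h.contDiffOn_velocity
  have hws : ContDiffOn ℝ ∞ w Ω := by
    refine ContDiffOn.congr (hKs.sub (ContDiffOn.mul ?_ (hTs.pow 2))) hw
    fun_prop
  have hfd : ∀ q ∈ Ω, ∀ e, fderiv ℝ w q e =
      2 * G (x q) (covAlong G x e (chartVelocity x) q) (chartVelocity x q) -
      A * Real.exp (2 * c * q.2) * (2 * c * e.2) * η (x q) (chartTangent G x q) ^ 2 -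
      A * Real.exp (2 * c * q.2) * (2 * η (x q) (chartTangent G x q) *
        η (x q) (covAlong G x e (chartTangent G x) q)) := by
    intro q hq e
    have e1 : w =ᶠ[nhds q] fun q => G (x q) (chartVelocity x q) (chartVelocity x q) -
      A * Real.exp (2 * c * q.2) * η (x q) (chartTangent G x q) ^ 2 :=
      Filter.eventually_of_mem (h.isOpen.mem_nhds hq) hw
    have e2 := (differentiableAt_of_contDiffOn h.isOpen hKs hq).hasFDerivAt.fun_sub
      ((hexp q).fun_mul ((differentiableAt_of_contDiffOn h.isOpen hTs hq).hasFDerivAt.pow 2))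
    rw [e1.fderiv_eq, e2.fderiv]
    have e3 := h.fderiv_metric h.contDiffOn_velocity h.contDiffOn_velocity hq e
    have e4 := h.fderiv_form h.contDiffOn_tangent hq e
    rw [h.metric_symm hq (chartVelocity x q)] at e3
    simp [e3, e4]
    ring
  have hPK := h.contDiffOn_metric h.contDiffOn_velocityDeriv h.contDiffOn_velocity
  have hηK := h.contDiffOn_form h.contDiffOn_velocity
  have hhs : ContDiffOn ℝ ∞ (fun q => 2 * G (x q) (chartVelocityDeriv G x q) (chartVelocity x q) -
      A * Real.exp (2 * c * q.2) * (2 * η (x q) (chartTangent G x q) *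
        η (x q) (chartVelocity x q))) Ω := by
    refine (contDiffOn_const.mul hPK).sub (ContDiffOn.mul ?_ ((contDiffOn_const.mul hTs).mul hηK))
    fun_prop
  obtain ⟨h1, h2, h3⟩ := derivatives_at_first_maximum h.isOpen hws hhs h.contDiffOn_speed hq
    (h.speed_pos hq)
    (fun q hq => by
      rw [hfd q hq, h.cov_space_tangent hq, h.cov_space_velocity hq]
      simp
      ring)
    (fun b hb => (hspace b hb).trans h0.ge) (fun s hs hsΩ => (htime s hs hsΩ).trans h0.ge)
  have e2 := ((differentiableAt_of_contDiffOn h.isOpen hPK hq).hasFDerivAt.const_mul 2).fun_sub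
    ((hexp (a, t)).fun_mul
      (((differentiableAt_of_contDiffOn h.isOpen hTs hq).hasFDerivAt.const_mul 2).fun_mul
        (differentiableAt_of_contDiffOn h.isOpen hηK hq).hasFDerivAt))
  rw [e2.fderiv] at h2
  have d1 := h.fderiv_metric h.contDiffOn_velocityDeriv h.contDiffOn_velocity hq (1, 0)
  have d2 := h.fderiv_form h.contDiffOn_tangent hq (1, 0)
  have d3 := h.fderiv_form h.contDiffOn_velocity hq (1, 0)
  rw [h.cov_space_velocity hq, map_smul, smul_eq_mul] at d1 d3
  rw [h.cov_space_tangent hq, map_smul, smul_eq_mul] at d2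
  simp [d1, d2, d3] at h2
  rw [hfd _ hq, h.cov_time_tangent hq, h.cov_time_velocity hq] at h3
  have hKT := h.metric_velocity_tangent hq
  have hTK := h.metric_symm hq (chartTangent G x (a, t)) (chartVelocity x (a, t))
  rw [hKT] at hTK
  simp [hTK] at h3
  have hw0 := hw _ hq
  rw [h0] at hw0
  have hPT := h.metric_velocityDeriv_tangent hq
  have hTT := h.metric_tangent_tangent hq
  have hTP := h.metric_symm hq (chartTangent G x (a, t)) (chartVelocityDeriv G x (a, t))
  have hKP := h.metric_symm hq (chartVelocity x (a, t)) (chartVelocityDeriv G x (a, t))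
  rw [hPT] at hTP
  have hS := h.speed_pos hq
  have hB : 0 < A * Real.exp (2 * c * t) := by positivity
  -- At the zero |K|² is a positive multiple of u², so K and T span a plane to which the curvature
  -- bound applies.
  have hqpos : 0 < G (x (a, t)) (chartVelocity x (a, t)) (chartVelocity x (a, t)) := by
    have : 0 < A * Real.exp (2 * c * t) * η (x (a, t)) (chartTangent G x (a, t)) ^ 2 := by
      positivity
    simp only at hw0
    linarith
  have hR := hsec (chartVelocity x (a, t)) (chartTangent G x (a, t)) (by
    rw [LinearIndependent.pair_iff]
    intro r s hrs
    have e1 : G (x (a, t)) (chartVelocity x (a, t))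
        (r • chartVelocity x (a, t) + s • chartTangent G x (a, t)) = 0 := by rw [hrs]; simp
    have e2 : G (x (a, t)) (chartTangent G x (a, t))
        (r • chartVelocity x (a, t) + s • chartTangent G x (a, t)) = 0 := by rw [hrs]; simp
    simp [hKT, hTK, hTT] at e1 e2
    exact ⟨e1.resolve_right hqpos.ne', e2⟩)
  rw [hKT, hTT, div_le_iff₀ (by simpa using hqpos)] at hR
  -- The component of P along T is -|K|², so P + |K|²T is its normal part; subtracting a multiple of
  -- K prepares Bessel's inequality.
  have hbessel := fun r : ℝ => h.metric_nonneg hq (chartVelocityDeriv G x (a, t) +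
    G (x (a, t)) (chartVelocity x (a, t)) (chartVelocity x (a, t)) • chartTangent G x (a, t) -
    r • chartVelocity x (a, t))
  simp only [map_add, map_sub, map_smul, add_apply, sub_apply, smul_apply, smul_eq_mul, hKT, hTK,
    hTT, hPT, hTP, hKP] at hbessel
  simp only at hw0 h1
  set B := A * Real.exp (2 * c * t)
  set k := G (x (a, t)) (chartVelocity x (a, t)) (chartVelocity x (a, t))
  set u := η (x (a, t)) (chartTangent G x (a, t))
  set S := chartSpeed G x (a, t)
  set m := G (x (a, t)) (chartVelocityDeriv G x (a, t)) (chartVelocity x (a, t))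
  set p := G (x (a, t)) (chartVelocityDeriv G x (a, t)) (chartVelocityDeriv G x (a, t))
  set z := η (x (a, t)) (chartVelocity x (a, t))
  set d := G (x (a, t)) (covAlong G x (1, 0) (chartVelocityDeriv G x) (a, t))
    (chartVelocity x (a, t))
  set R := G (x (a, t)) (riemannCurvature G (x (a, t)) (chartVelocity x (a, t))
    (chartTangent G x (a, t)) (chartTangent G x (a, t))) (chartVelocity x (a, t))
  -- Half of the inequality w_ss ≤ 0, where s is arc length.
  have hdS : S⁻¹ * d + p ≤ B * u * η (x (a, t)) (chartVelocityDeriv G x (a, t)) + B * z ^ 2 := by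
    have : S * (S⁻¹ * d + p) ≤
        S * (B * u * η (x (a, t)) (chartVelocityDeriv G x (a, t)) + B * z ^ 2) := by
      rw [mul_add, mul_inv_cancel_left₀ hS.ne']
      linarith
    exact le_of_mul_le_mul_left this hS
  have hk : k = B * u ^ 2 := by linarith
  have hm : m = B * u * z := by linarith
  -- Since m = Buz and k = Bu², the number z / u equals m / k, the coefficient of the orthogonal
  -- projection of P onto K.
  have hb := hbessel (z / u)
  have hb1 : z / u * m = B * z ^ 2 := by rw [hm]; field_simp
  have hb2 : z / u * (z / u * k) = B * z ^ 2 := by rw [hk]; field_simp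
  have hb3 : 0 ≤ p - k * k - B * z ^ 2 := by linarith
  -- By `hdS` and `hb3` the gradient terms leave 0 ≤ w_t / 2 ≤ R - ck ≤ (Ξ - c)k, which is negative.
  have hck : 0 < (c - Ξ) * k := mul_pos (by linarith) hqpos
  have hBk : B * (2 * c) * u ^ 2 = 2 * c * k := by rw [hk]; ring
  have hBk' : B * (2 * u * (k * u)) = 2 * k * k := by
    calc B * (2 * u * (k * u)) = 2 * k * (B * u ^ 2) := by ring
      _ = 2 * k * k := by rw [← hk]
  linarith

end IsChartFlow
end ChartFlow

/-! ### Charts of a Riemannian manifold -/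

section Charts

variable {E : Type*} [NormedAddCommGroup E] [NormedSpace ℝ E]
  {H : Type*} [TopologicalSpace H] (I : ModelWithCorners ℝ E H)
  {X : Type*} [TopologicalSpace X] [ChartedSpace H X]

/-- The derivative at `p` of the preferred chart around `x`. -/
def chartDeriv (x p : X) : E →L[ℝ] E := mfderiv I 𝓘(ℝ, E) (extChartAt I x) p

/-- The derivative at `y` of the inverse of the preferred chart around `x`. -/
def chartSymmDeriv (x : X) (y : E) : E →L[ℝ] E := mfderiv 𝓘(ℝ, E) I (extChartAt I x).symm y

/-- The transition map between two preferred charts. -/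
def chartTransition (x x' : X) (y : E) : E := extChartAt I x' ((extChartAt I x).symm y)

/-- The metric `g` at `p` as a bilinear form on the model space. -/
def metricAt (g : ∀ x : X, TangentSpace I x →L[ℝ] TangentSpace I x →L[ℝ] ℝ) (p : X) :
    E →L[ℝ] E →L[ℝ] ℝ := g p

/-- The velocity of a curve as an element of the model space. -/
def modelVelocity (c : ℝ → X) (a : ℝ) : E := velocity I c a

/-- The curvature vector of a curve as an element of the model space. -/
def modelCurvature (g : ∀ x : X, TangentSpace I x →L[ℝ] TangentSpace I x →L[ℝ] ℝ) (c : ℝ → X)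
    (a : ℝ) : E := curvatureVector I g c a

/-- The unit tangent vector of a curve as an element of the model space. -/
def modelTangent (g : ∀ x : X, TangentSpace I x →L[ℝ] TangentSpace I x →L[ℝ] ℝ) (c : ℝ → X)
    (a : ℝ) : E := unitTangent I g c a

lemma modelTangent_eq (g : ∀ x : X, TangentSpace I x →L[ℝ] TangentSpace I x →L[ℝ] ℝ)
    (c : ℝ → X) (a : ℝ) : modelTangent I g c a = (speed I g c a)⁻¹ • modelVelocity I c a := rfl

lemma speed_eq (g : ∀ x : X, TangentSpace I x →L[ℝ] TangentSpace I x →L[ℝ] ℝ) (c : ℝ → X)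
    (a : ℝ) : speed I g c a =
      √(metricAt I g (c a) (modelVelocity I c a) (modelVelocity I c a)) := rfl

lemma chartMetric_apply (g : ∀ x : X, TangentSpace I x →L[ℝ] TangentSpace I x →L[ℝ] ℝ)
    (x : X) (y v w : E) : chartMetric I g x y v w =
      metricAt I g ((extChartAt I x).symm y) (chartSymmDeriv I x y v)
        (chartSymmDeriv I x y w) := rfl

variable [I.Boundaryless] [IsManifold I ∞ X] {I}

lemma chartDeriv_chartSymmDeriv {x : X} {y : E} (hy : y ∈ (extChartAt I x).target) (v : E) :
    chartDeriv I x ((extChartAt I x).symm y) (chartSymmDeriv I x y v) = v := by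
  have h := mfderiv_extChartAt_comp_mfderivWithin_extChartAt_symm (I := I) hy
  rw [I.range_eq_univ, mfderivWithin_univ] at h
  exact DFunLike.congr_fun h v

lemma chartSymmDeriv_chartDeriv {x p : X} (hp : p ∈ (extChartAt I x).source) (v : E) :
    chartSymmDeriv I x (extChartAt I x p) (chartDeriv I x p v) = v := by
  have h := mfderivWithin_extChartAt_symm_comp_mfderiv_extChartAt (I := I)
    ((extChartAt I x).map_source hp)
  rw [I.range_eq_univ, mfderivWithin_univ, (extChartAt I x).left_inv hp] at h
  exact DFunLike.congr_fun h v

lemma chartMetric_chartDeriv (g : ∀ x : X, TangentSpace I x →L[ℝ] TangentSpace I x →L[ℝ] ℝ)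
    {x p : X} (hp : p ∈ (extChartAt I x).source) (v w : E) :
    chartMetric I g x (extChartAt I x p) (chartDeriv I x p v) (chartDeriv I x p w) =
      metricAt I g p v w := by
  rw [chartMetric_apply, chartSymmDeriv_chartDeriv hp, chartSymmDeriv_chartDeriv hp,
    (extChartAt I x).left_inv hp]

lemma mdifferentiableAt_extChartAt_symm {x : X} {y : E} (hy : y ∈ (extChartAt I x).target) :
    MDifferentiableAt 𝓘(ℝ, E) I (extChartAt I x).symm y := by
  have h := mdifferentiableWithinAt_extChartAt_symm (I := I) hy
  rwa [I.range_eq_univ, mdifferentiableWithinAt_univ] at h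

omit [I.Boundaryless] in
lemma mdifferentiableAt_extChartAt_of_mem {x p : X} (hp : p ∈ (extChartAt I x).source) :
    MDifferentiableAt I 𝓘(ℝ, E) (extChartAt I x) p :=
  mdifferentiableAt_extChartAt (by rwa [extChartAt_source] at hp)

omit [I.Boundaryless] in
lemma chartDeriv_mfderivWithin {x : X} {c : ℝ → X} {S : Set ℝ} {a : ℝ}
    (hc : MDifferentiableWithinAt 𝓘(ℝ, ℝ) I c S a) (hS : UniqueDiffWithinAt ℝ S a)
    (hx : c a ∈ (extChartAt I x).source) :
    chartDeriv I x (c a) (mfderivWithin 𝓘(ℝ, ℝ) I c S a (1 : ℝ)) =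
      derivWithin (fun b => extChartAt I x (c b)) S a := by
  have h := mfderiv_comp_mfderivWithin (I := 𝓘(ℝ, ℝ)) (I' := I) (I'' := 𝓘(ℝ, E)) a
    (mdifferentiableAt_extChartAt_of_mem hx) hc hS.uniqueMDiffWithinAt
  rw [mfderivWithin_eq_fderivWithin] at h
  exact (DFunLike.congr_fun h (1 : ℝ)).symm

omit [I.Boundaryless] in
lemma chartDeriv_velocity {x : X} {c : ℝ → X} {a : ℝ}
    (hc : MDifferentiableAt 𝓘(ℝ, ℝ) I c a) (hx : c a ∈ (extChartAt I x).source) :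
    chartDeriv I x (c a) (modelVelocity I c a) = deriv (fun b => extChartAt I x (c b)) a := by
  have h := chartDeriv_mfderivWithin (S := Set.univ) hc.mdifferentiableWithinAt
    uniqueDiffWithinAt_univ hx
  rwa [mfderivWithin_univ, derivWithin_univ] at h

lemma fderiv_chartTransition {x x' : X} {y : E} (hy : y ∈ (extChartAt I x).target)
    (hy' : (extChartAt I x).symm y ∈ (extChartAt I x').source) (v : E) :
    fderiv ℝ (chartTransition I x x') y v =
      chartDeriv I x' ((extChartAt I x).symm y) (chartSymmDeriv I x y v) := by
  have h := mfderiv_comp (I := 𝓘(ℝ, E)) (I' := I) (I'' := 𝓘(ℝ, E)) y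
    (mdifferentiableAt_extChartAt_of_mem hy') (mdifferentiableAt_extChartAt_symm hy)
  rw [mfderiv_eq_fderiv] at h
  exact DFunLike.congr_fun h v

lemma contDiffAt_chartTransition {x x' : X} {y : E} (hy : y ∈ (extChartAt I x).target)
    (hy' : (extChartAt I x).symm y ∈ (extChartAt I x').source) :
    ContDiffAt ℝ ∞ (chartTransition I x x') y := by
  have h1 : ContMDiffAt 𝓘(ℝ, E) I ∞ (extChartAt I x).symm y :=
    (contMDiffOn_extChartAt_symm x).contMDiffAt ((isOpen_extChartAt_target x).mem_nhds hy)
  have h2 : ContMDiffAt I 𝓘(ℝ, E) ∞ (extChartAt I x') ((extChartAt I x).symm y) :=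
    contMDiffAt_extChartAt' (by rwa [extChartAt_source] at hy')
  exact (h2.comp y h1).contDiffAt

lemma fderiv_chartTransition_chartDeriv {x x' p : X} (hp : p ∈ (extChartAt I x).source)
    (hp' : p ∈ (extChartAt I x').source) (v : E) :
    fderiv ℝ (chartTransition I x x') (extChartAt I x p) (chartDeriv I x p v) =
      chartDeriv I x' p v := by
  have h := (extChartAt I x).left_inv hp
  rw [fderiv_chartTransition ((extChartAt I x).map_source hp) (by rwa [h]),
    chartSymmDeriv_chartDeriv hp, h]

/-- `g` is a smooth Riemannian metric: it is symmetric, positive definite, and smooth in charts. -/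
structure IsSmoothMetric (g : ∀ x : X, TangentSpace I x →L[ℝ] TangentSpace I x →L[ℝ] ℝ) :
    Prop where
  symm : ∀ (x : X) (v w : E), metricAt I g x v w = metricAt I g x w v
  pos : ∀ (x : X) (v : E), v ≠ 0 → 0 < metricAt I g x v v
  smooth : ∀ x, ContDiffOn ℝ ∞ (chartMetric I g x) (extChartAt I x).target

variable {g : ∀ x : X, TangentSpace I x →L[ℝ] TangentSpace I x →L[ℝ] ℝ}

lemma IsSmoothMetric.isLocalMetric (hg : IsSmoothMetric g) (x : X) :
    IsLocalMetric (chartMetric I g x) (extChartAt I x).target where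
  isOpen := isOpen_extChartAt_target x
  smooth := hg.smooth x
  symm y _ v w := by
    rw [chartMetric_apply, chartMetric_apply, hg.symm]
  pos y hy v hv := by
    rw [chartMetric_apply]
    refine hg.pos _ _ fun h0 => hv ?_
    rw [← chartDeriv_chartSymmDeriv hy v, h0, map_zero]

lemma chartMetric_eq_pullback {x x' : X} {y : E} (hy : y ∈ (extChartAt I x).target)
    (hy' : (extChartAt I x).symm y ∈ (extChartAt I x').source) (v w : E) :
    chartMetric I g x y v w = chartMetric I g x' (chartTransition I x x' y)
      (fderiv ℝ (chartTransition I x x') y v) (fderiv ℝ (chartTransition I x x') y w) := by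
  rw [fderiv_chartTransition hy hy', fderiv_chartTransition hy hy', chartTransition,
    chartMetric_chartDeriv g hy', chartMetric_apply]

lemma eventually_mem_transition_source {x x' p : X} (hp : p ∈ (extChartAt I x).source)
    (hp' : p ∈ (extChartAt I x').source) :
    ∀ᶠ y in nhds (extChartAt I x p), y ∈ (extChartAt I x).target ∧
      (extChartAt I x).symm y ∈ (extChartAt I x').source := by
  have ht := (extChartAt I x).map_source hp
  have h1 := (isOpen_extChartAt_target (I := I) x).mem_nhds ht
  refine Filter.Eventually.and h1 ?_
  have h2 : ContinuousAt (extChartAt I x).symm (extChartAt I x p) :=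
    (mdifferentiableAt_extChartAt_symm ht).continuousAt
  refine h2.eventually_mem ?_
  rw [(extChartAt I x).left_inv hp]
  exact (isOpen_extChartAt_source x').mem_nhds hp'

/-- The covariant derivative along a curve, computed in any chart. -/
lemma chartDeriv_covDerivAlong [FiniteDimensional ℝ E] (hg : IsSmoothMetric g) {x : X}
    {c : ℝ → X} {a : ℝ}
    (hc : MDifferentiableAt 𝓘(ℝ, ℝ) I c a) (hx : c a ∈ (extChartAt I x).source)
    (V : ℝ → E)
    (hV : DifferentiableAt ℝ (fun b => chartDeriv I x (c b) (V b)) a) :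
    chartDeriv I x (c a) (covDerivAlong I g c V a) =
      deriv (fun b => chartDeriv I x (c b) (V b)) a +
        christoffel (chartMetric I g x) (extChartAt I x (c a))
          (deriv (fun b => extChartAt I x (c b)) a) (chartDeriv I x (c a) (V a)) := by
  have hx₀ : c a ∈ (extChartAt I (c a)).source := mem_extChartAt_source (c a)
  have hev : ∀ᶠ b in nhds a, c b ∈ (extChartAt I x).source ∧ c b ∈ (extChartAt I (c a)).source :=
    (hc.continuousAt.eventually_mem ((isOpen_extChartAt_source x).mem_nhds hx)).and
      (hc.continuousAt.eventually_mem ((isOpen_extChartAt_source (c a)).mem_nhds hx₀))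
  have hchart : ∀ {x'}, c a ∈ (extChartAt I x').source →
      HasDerivAt (fun b => extChartAt I x' (c b)) (chartDeriv I x' (c a) (modelVelocity I c a)) a := by
    intro x' hx'
    rw [chartDeriv_velocity hc hx']
    have := (mdifferentiableAt_extChartAt_of_mem hx').comp a hc
    exact this.differentiableAt.hasDerivAt
  have hd2 : ∀ {x x'}, c a ∈ (extChartAt I x).source → c a ∈ (extChartAt I x').source →
      HasDerivAt (fun b => fderiv ℝ (chartTransition I x x') (extChartAt I x (c b)))
        (fderiv ℝ (fderiv ℝ (chartTransition I x x')) (extChartAt I x (c a))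
          (chartDeriv I x (c a) (modelVelocity I c a))) a := by
    intro x x' hx hx'
    have h1 := contDiffAt_chartTransition (I := I) (x := x) (x' := x')
      ((extChartAt I x).map_source hx) (by rwa [(extChartAt I x).left_inv hx])
    have h2 : DifferentiableAt ℝ (fderiv ℝ (chartTransition I x x')) (extChartAt I x (c a)) :=
      (h1.fderiv_right (m := 1) (by norm_cast)).differentiableAt (by simp)
    exact h2.hasFDerivAt.comp_hasDerivAt a (hchart hx)
  -- `covDerivAlong` works in the chart around `c a`; differentiability is carried there by the
  -- transition map.
  have hW₀ : DifferentiableAt ℝ (fun b => chartDeriv I (c a) (c b) (V b)) a := by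
    have h1 := (hd2 hx hx₀).clm_apply hV.hasDerivAt
    refine h1.differentiableAt.congr_of_eventuallyEq ?_
    filter_upwards [hev] with b hb
    exact (fderiv_chartTransition_chartDeriv hb.1 hb.2 _).symm
  have hW : HasDerivAt (fun b => chartDeriv I x (c b) (V b))
      (fderiv ℝ (fderiv ℝ (chartTransition I (c a) x)) (extChartAt I (c a) (c a))
        (chartDeriv I (c a) (c a) (modelVelocity I c a)) (chartDeriv I (c a) (c a) (V a)) +
      fderiv ℝ (chartTransition I (c a) x) (extChartAt I (c a) (c a))
        (deriv (fun b => chartDeriv I (c a) (c b) (V b)) a)) a := by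
    refine ((hd2 hx₀ hx).clm_apply hW₀.hasDerivAt).congr_of_eventuallyEq ?_
    filter_upwards [hev] with b hb
    exact (fderiv_chartTransition_chartDeriv hb.2 hb.1 _).symm
  have hcov : covDerivAlong I g c V a = chartSymmDeriv I (c a) (extChartAt I (c a) (c a))
      (deriv (fun b => chartDeriv I (c a) (c b) (V b)) a +
        christoffel (chartMetric I g (c a)) (extChartAt I (c a) (c a))
          (deriv (fun b => extChartAt I (c a) (c b)) a) (chartDeriv I (c a) (c a) (V a))) := rfl
  have ht₀ := (extChartAt I (c a)).map_source hx₀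
  have hinv := (extChartAt I (c a)).left_inv hx₀
  have htr := fderiv_chartTransition (I := I) (x := c a) (x' := x) ht₀ (by rwa [hinv])
  rw [hinv] at htr
  have hφ : chartTransition I (c a) x (extChartAt I (c a) (c a)) = extChartAt I x (c a) := by
    rw [chartTransition, hinv]
  -- The second derivative of the transition map in the law for Christoffel symbols is the one that
  -- appears in `hW`, so the two expressions agree.
  have hpull := (hg.isLocalMetric x).fderiv_christoffel_pullback (hg.isLocalMetric (c a))
    (φ := chartTransition I (c a) x) ht₀ (by rw [hφ]; exact (extChartAt I x).map_source hx)
    (contDiffAt_chartTransition ht₀ (by rwa [hinv]))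
    (fun w => ⟨chartDeriv I (c a) (c a) (chartSymmDeriv I x (extChartAt I x (c a)) w), by
      rw [fderiv_chartTransition_chartDeriv hx₀ hx]
      have := chartDeriv_chartSymmDeriv ((extChartAt I x).map_source hx) w
      rwa [(extChartAt I x).left_inv hx] at this⟩)
    ((eventually_mem_transition_source hx₀ hx).mono fun y hy v w =>
      chartMetric_eq_pullback hy.1 hy.2 v w)
  rw [hcov, ← htr, map_add, hpull, hφ, (hchart hx₀).deriv, (hchart hx).deriv, hW.deriv,
    fderiv_chartTransition_chartDeriv hx₀ hx, fderiv_chartTransition_chartDeriv hx₀ hx]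
  abel

/-- The curvature vector of a curve, computed in any chart. -/
lemma chartDeriv_modelCurvature [FiniteDimensional ℝ E] (hg : IsSmoothMetric g) {x : X}
    {c : ℝ → X} {a : ℝ}
    (hc : MDifferentiableAt 𝓘(ℝ, ℝ) I c a) (hx : c a ∈ (extChartAt I x).source)
    (hV : DifferentiableAt ℝ (fun b => chartDeriv I x (c b) (modelTangent I g c b)) a) :
    chartDeriv I x (c a) (modelCurvature I g c a) = (speed I g c a)⁻¹ •
      (deriv (fun b => chartDeriv I x (c b) (modelTangent I g c b)) a +
        christoffel (chartMetric I g x) (extChartAt I x (c a))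
          (deriv (fun b => extChartAt I x (c b)) a)
          (chartDeriv I x (c a) (modelTangent I g c a))) := by
  rw [← chartDeriv_covDerivAlong hg hc hx _ hV]
  exact (chartDeriv I x (c a)).map_smul (speed I g c a)⁻¹
    (covDerivAlong I g c (modelTangent I g c) a)

end Charts

/-! ### Curve shortening flow in a Riemannian manifold with a parallel one-form -/

lemma isOpen_time (τ : EReal) : IsOpen {t : ℝ | 0 < t ∧ (t : EReal) < τ} :=
  (isOpen_lt continuous_const continuous_id).inter
    (isOpen_lt continuous_coe_real_ereal continuous_const)

/-- Convexity and nonempty interior. This makes the one-sided time derivative at time zero well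
determined. -/
lemma uniqueDiffOn_timeInterval {τ : EReal} (hτ : 0 < τ) : UniqueDiffOn ℝ (timeInterval τ) := by
  have hconv : Convex ℝ (timeInterval τ) := by
    refine Set.OrdConnected.convex ⟨fun s hs t ht r hr => ⟨hs.1.trans hr.1, ?_⟩⟩
    exact lt_of_le_of_lt (by exact_mod_cast hr.2) ht.2
  refine uniqueDiffOn_convex hconv ?_
  obtain ⟨r, hr0, hrτ⟩ := EReal.lt_iff_exists_real_btwn.1 hτ
  exact ⟨r, mem_interior.2 ⟨_, fun t ht => ⟨ht.1.le, ht.2⟩, isOpen_time τ,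
    ⟨by exact_mod_cast hr0, hrτ⟩⟩⟩

lemma timeInterval_icc {τ : EReal} {t : ℝ} (ht : t ∈ timeInterval τ) :
    0 ≤ t ∧ Set.Icc 0 t ⊆ timeInterval τ :=
  ⟨ht.1, fun _ hs => ⟨hs.1, lt_of_le_of_lt (by exact_mod_cast hs.2) ht.2⟩⟩

section Manifold

variable {E : Type*} [NormedAddCommGroup E] [NormedSpace ℝ E]
  {H : Type*} [TopologicalSpace H] (I : ModelWithCorners ℝ E H)
  {X : Type*} [TopologicalSpace X] [ChartedSpace H X]

/-- The one-form `θ` in the preferred chart around `x`. -/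
def chartForm (θ : X → E →L[ℝ] ℝ) (x : X) (y : E) : E →L[ℝ] ℝ :=
  (θ ((extChartAt I x).symm y)).comp (chartSymmDeriv I x y)

/-- `θ` is a smooth one-form which is parallel with respect to the metric `g`. -/
structure IsParallelForm (g : ∀ x : X, TangentSpace I x →L[ℝ] TangentSpace I x →L[ℝ] ℝ)
    (θ : X → E →L[ℝ] ℝ) : Prop where
  smooth : ∀ x, ContDiffOn ℝ ∞ (chartForm I θ x) (extChartAt I x).target
  parallel : ∀ x, ∀ y ∈ (extChartAt I x).target, ∀ v w,
    chartForm I θ x y (christoffel (chartMetric I g x) y v w) = fderiv ℝ (chartForm I θ x) y v w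

/-- The square of the curvature of a family of closed curves. -/
def curvatureSq (g : ∀ x : X, TangentSpace I x →L[ℝ] TangentSpace I x →L[ℝ] ℝ)
    (γ : Circle → ℝ → X) (b s : ℝ) : ℝ :=
  metricAt I g (γ (Circle.exp b) s) (modelCurvature I g (angular fun z => γ z s) b)
    (modelCurvature I g (angular fun z => γ z s) b)

/-- The value of the one-form `θ` on the unit tangent vectors of a family of closed curves. -/
def formTangent (g : ∀ x : X, TangentSpace I x →L[ℝ] TangentSpace I x →L[ℝ] ℝ)
    (θ : X → E →L[ℝ] ℝ) (γ : Circle → ℝ → X) (b s : ℝ) : ℝ :=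
  θ (γ (Circle.exp b) s) (modelTangent I g (angular fun z => γ z s) b)

variable {I} [I.Boundaryless] [IsManifold I ∞ X]
  {g : ∀ x : X, TangentSpace I x →L[ℝ] TangentSpace I x →L[ℝ] ℝ} {θ : X → E →L[ℝ] ℝ}

lemma chartForm_chartDeriv {x p : X} (hp : p ∈ (extChartAt I x).source) (v : E) :
    chartForm I θ x (extChartAt I x p) (chartDeriv I x p v) = θ p v := by
  rw [chartForm, ContinuousLinearMap.comp_apply, chartSymmDeriv_chartDeriv hp,
    (extChartAt I x).left_inv hp]

omit [I.Boundaryless] [IsManifold I ∞ X] in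
lemma sectionalCurvature_eq (x : X) (v w : E) : sectionalCurvature I g x v w =
    chartMetric I g x (extChartAt I x x) (riemannCurvature (chartMetric I g x) (extChartAt I x x)
      (chartDeriv I x x v) (chartDeriv I x x w) (chartDeriv I x x w)) (chartDeriv I x x v) /
    (chartMetric I g x (extChartAt I x x) (chartDeriv I x x v) (chartDeriv I x x v) *
      chartMetric I g x (extChartAt I x x) (chartDeriv I x x w) (chartDeriv I x x w) -
      chartMetric I g x (extChartAt I x x) (chartDeriv I x x v) (chartDeriv I x x w) ^ 2) := rfl

omit [I.Boundaryless] [IsManifold I ∞ X] in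
lemma modelVelocity_periodic {c : ℝ → X} {h : ℝ} (hc : MDifferentiable 𝓘(ℝ, ℝ) I c)
    (hper : Function.Periodic c h) : Function.Periodic (modelVelocity I c) h := by
  intro a
  have h1 : MDifferentiableAt 𝓘(ℝ, ℝ) 𝓘(ℝ, ℝ) (fun b : ℝ => b + h) a :=
    (differentiableAt_id.add_const h).mdifferentiableAt
  have h2 := mfderiv_comp (I := 𝓘(ℝ, ℝ)) (I' := 𝓘(ℝ, ℝ)) (I'' := I) a (hc (a + h)) h1
  have h3 : c ∘ (fun b : ℝ => b + h) = c := funext hper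
  have h4 : ∀ c', c' = c → modelVelocity I c' a = modelVelocity I c a := by rintro _ rfl; rfl
  rw [← h4 _ h3]
  have h5 : mfderiv 𝓘(ℝ, ℝ) 𝓘(ℝ, ℝ) (fun b : ℝ => b + h) a = ContinuousLinearMap.id ℝ ℝ := by
    rw [mfderiv_eq_fderiv, fderiv_add_const]
    exact fderiv_fun_id
  have h6 := DFunLike.congr_fun h2 (1 : ℝ)
  rw [h5] at h6
  exact h6.symm

-- Needed for r = ±1, because U may be either of the two unit fields on the circle.
omit [I.Boundaryless] [IsManifold I ∞ X] in
lemma IsParallelForm.const_smul (hθ : IsParallelForm I g θ) (r : ℝ) :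
    IsParallelForm I g (fun p => r • θ p) := by
  have h1 : ∀ x, chartForm I (fun p => r • θ p) x = r • chartForm I θ x := fun x => by
    ext y v
    simp [chartForm]
  refine ⟨fun x => ?_, fun x y hy v w => ?_⟩
  · rw [h1]
    exact (hθ.smooth x).const_smul r
  · rw [h1, fderiv_const_smul_field]
    simp [hθ.parallel x y hy]

variable {τ : EReal} {γ : Circle → ℝ → X}

/-! ### Periodicity and continuity of curvature and tangent up to time zero. -/

namespace IsCurveShorteningFlow

section

variable (h : IsCurveShorteningFlow I g τ γ)
include h

omit [I.Boundaryless] [IsManifold I ∞ X] in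
lemma contMDiffOn_family : ContMDiffOn 𝓘(ℝ, ℝ × ℝ) I ∞
    (fun q : ℝ × ℝ => γ (Circle.exp q.1) q.2) (Set.univ ×ˢ timeInterval τ) := by
  have h1 : ContMDiff 𝓘(ℝ, ℝ × ℝ) ((𝓡 1).prod 𝓘(ℝ, ℝ)) ∞
      (fun q : ℝ × ℝ => (Circle.exp q.1, q.2)) :=
    (contMDiff_circleExp.comp contDiff_fst.contMDiff).prodMk contDiff_snd.contMDiff
  exact h.smooth.comp h1.contMDiffOn fun q hq => ⟨Set.mem_univ _, hq.2⟩

omit [I.Boundaryless] [IsManifold I ∞ X] in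
lemma mdifferentiable_angular {s : ℝ} (hs : s ∈ timeInterval τ) :
    MDifferentiable 𝓘(ℝ, ℝ) I (angular fun z => γ z s) :=
  ((h.immersed s hs).1.comp contMDiff_circleExp).mdifferentiable (by simp)

omit [I.Boundaryless] [IsManifold I ∞ X] in
lemma mdifferentiableWithinAt_time {s : ℝ} (hs : s ∈ timeInterval τ) (z : Circle) :
    MDifferentiableWithinAt 𝓘(ℝ, ℝ) I (γ z) (timeInterval τ) s := by
  have h1 : ContMDiff 𝓘(ℝ, ℝ) ((𝓡 1).prod 𝓘(ℝ, ℝ)) ∞ (fun s : ℝ => (z, s)) :=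
    contMDiff_const.prodMk contMDiff_id
  have h2 : ContMDiffOn 𝓘(ℝ, ℝ) I ∞ (γ z) (timeInterval τ) :=
    h.smooth.comp h1.contMDiffOn fun q hq => ⟨Set.mem_univ _, hq⟩
  exact (h2 s hs).mdifferentiableWithinAt (by simp)

omit [I.Boundaryless] [IsManifold I ∞ X] in
lemma modelCurvature_eq {s : ℝ} (hs : s ∈ timeInterval τ) (b : ℝ) :
    modelCurvature I g (angular fun z => γ z s) b =
      mfderivWithin 𝓘(ℝ, ℝ) I (γ (Circle.exp b)) (timeInterval τ) s (1 : ℝ) :=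
  (h.evolution s hs b).symm

-- By the flow equation the curvature vector is a time derivative at a point of the circle, hence
-- independent of the choice of angle.
omit [I.Boundaryless] [IsManifold I ∞ X] in
lemma periodic_curvatureSq {s : ℝ} (hs : s ∈ timeInterval τ) :
    Function.Periodic (fun b => curvatureSq I g γ b s) (2 * Real.pi) := by
  obtain ⟨F, hF⟩ : ∃ F : Circle → ℝ, ∀ b, curvatureSq I g γ b s = F (Circle.exp b) :=
    ⟨fun z => metricAt I g (γ z s) (mfderivWithin 𝓘(ℝ, ℝ) I (γ z) (timeInterval τ) s (1 : ℝ))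
      (mfderivWithin 𝓘(ℝ, ℝ) I (γ z) (timeInterval τ) s (1 : ℝ)), fun b => by
        rw [curvatureSq, h.modelCurvature_eq hs]⟩
  intro b
  simp only [hF, Circle.periodic_exp b]

omit [I.Boundaryless] [IsManifold I ∞ X] in
lemma periodic_formTangent {s : ℝ} (hs : s ∈ timeInterval τ) :
    Function.Periodic (fun b => formTangent I g θ γ b s) (2 * Real.pi) := by
  have hper : Function.Periodic (angular fun z => γ z s) (2 * Real.pi) := fun b => by
    simp only [angular, Circle.periodic_exp b]
  intro b
  have hv := modelVelocity_periodic (h.mdifferentiable_angular hs) hper b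
  simp only [formTangent, modelTangent_eq, speed_eq, hv, hper b, Circle.periodic_exp b]

omit [I.Boundaryless] in
/-- The derivatives of the flow in a chart. -/
lemma exists_chart (hτ : 0 < τ) (x : X) {V : Set (ℝ × ℝ)} (hV : IsOpen V)
    (hVx : ∀ q ∈ V ∩ Set.univ ×ˢ timeInterval τ,
      γ (Circle.exp q.1) q.2 ∈ (extChartAt I x).source) :
    ContDiffOn ℝ ∞ (fun q : ℝ × ℝ => extChartAt I x (γ (Circle.exp q.1) q.2))
      (V ∩ Set.univ ×ˢ timeInterval τ) ∧
    ∀ q ∈ V ∩ Set.univ ×ˢ timeInterval τ,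
      fderivWithin ℝ (fun q : ℝ × ℝ => extChartAt I x (γ (Circle.exp q.1) q.2))
        (V ∩ Set.univ ×ˢ timeInterval τ) q (1, 0) =
          chartDeriv I x (γ (Circle.exp q.1) q.2)
            (modelVelocity I (angular fun z => γ z q.2) q.1) ∧
      fderivWithin ℝ (fun q : ℝ × ℝ => extChartAt I x (γ (Circle.exp q.1) q.2))
        (V ∩ Set.univ ×ˢ timeInterval τ) q (0, 1) =
          chartDeriv I x (γ (Circle.exp q.1) q.2)
            (modelCurvature I g (angular fun z => γ z q.2) q.1) := by
  have hsm : ContDiffOn ℝ ∞ (fun q : ℝ × ℝ => extChartAt I x (γ (Circle.exp q.1) q.2))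
      (V ∩ Set.univ ×ˢ timeInterval τ) := by
    have h1 : ContMDiffOn I 𝓘(ℝ, E) ∞ (extChartAt I x) (extChartAt I x).source := by
      rw [extChartAt_source]; exact contMDiffOn_extChartAt
    exact (h1.comp (h.contMDiffOn_family.mono Set.inter_subset_right) hVx).contDiffOn
  refine ⟨hsm, fun q hq => ?_⟩
  have hq2 := hq.2.2
  have hd := ((hsm q hq).differentiableWithinAt (by simp)).hasFDerivWithinAt
  constructor
  · refine Eq.trans ?_ (chartDeriv_velocity (h.mdifferentiable_angular hq2 q.1) (hVx q hq)).symm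
    have hline : HasDerivAt (fun b : ℝ => (b, q.2)) ((1, 0) : ℝ × ℝ) q.1 :=
      (hasDerivAt_id q.1).prodMk (hasDerivAt_const q.1 q.2)
    have hmaps : ∀ᶠ b in nhds q.1, (b, q.2) ∈ V ∩ Set.univ ×ˢ timeInterval τ := by
      filter_upwards [hline.continuousAt.eventually_mem (hV.mem_nhds hq.1)] with b hb
      exact ⟨hb, Set.mem_univ _, hq2⟩
    exact (hd.comp_hasDerivAt_of_eq q.1 hline hmaps rfl).deriv.symm
  · rw [h.modelCurvature_eq hq2, chartDeriv_mfderivWithin (h.mdifferentiableWithinAt_time hq2 _)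
      (uniqueDiffOn_timeInterval hτ q.2 hq2) (hVx q hq)]
    have hline : HasDerivAt (fun s : ℝ => (q.1, s)) ((0, 1) : ℝ × ℝ) q.2 :=
      (hasDerivAt_const q.2 q.1).prodMk (hasDerivAt_id q.2)
    have hmem : V ∩ Set.univ ×ˢ timeInterval τ ∈ nhdsWithin q (Set.univ ×ˢ timeInterval τ) :=
      Filter.inter_mem (mem_nhdsWithin_of_mem_nhds (hV.mem_nhds hq.1)) self_mem_nhdsWithin
    have hd' := hd.mono_of_mem_nhdsWithin hmem
    have hmaps : Set.MapsTo (fun s : ℝ => (q.1, s)) (timeInterval τ)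
        (Set.univ ×ˢ timeInterval τ) := fun s hs => ⟨Set.mem_univ _, hs⟩
    have hcomp := hd'.comp_hasDerivWithinAt q.2 hline.hasDerivWithinAt hmaps
    exact (hcomp.derivWithin (uniqueDiffOn_timeInterval hτ q.2 hq2)).symm

omit [IsManifold I ∞ X] [I.Boundaryless] in
lemma exists_chart_domain {a t : ℝ} (ht : t ∈ timeInterval τ) : ∃ V : Set (ℝ × ℝ), IsOpen V ∧
    (a, t) ∈ V ∧ ∀ q ∈ V ∩ Set.univ ×ˢ timeInterval τ, γ (Circle.exp q.1) q.2 ∈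
      (extChartAt I (γ (Circle.exp a) t)).source := by
  have h1 := h.contMDiffOn_family.continuousOn (a, t) ⟨Set.mem_univ _, ht⟩
  have h2 := h1 (extChartAt_source_mem_nhds (I := I) (γ (Circle.exp a) t))
  obtain ⟨V, hV, hmem, hsub⟩ := mem_nhdsWithin.1 h2
  exact ⟨V, hV, hmem, fun q hq => hsub hq⟩

/-- By the flow equation |K|² is the squared time derivative, so in a chart both functions involve
only first derivatives of the flow, which are continuous up to time zero as derivatives within the
domain. -/
lemma continuousOn_curvatureSq_formTangent (hτ : 0 < τ) (hg : IsSmoothMetric g)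
    (hθ : IsParallelForm I g θ) :
    ContinuousOn (fun q : ℝ × ℝ => curvatureSq I g γ q.1 q.2) (Set.univ ×ˢ timeInterval τ) ∧
    ContinuousOn (fun q : ℝ × ℝ => formTangent I g θ γ q.1 q.2) (Set.univ ×ˢ timeInterval τ) := by
  rw [ContinuousOn, ContinuousOn, ← forall₂_and]
  rintro ⟨a, t⟩ hq
  obtain ⟨V, hV, hmem, hVx⟩ := h.exists_chart_domain (a := a) hq.2
  obtain ⟨hsm, hder⟩ := h.exists_chart hτ _ hV hVx
  set x := γ (Circle.exp a) t
  set D := V ∩ Set.univ ×ˢ timeInterval τ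
  set f : ℝ × ℝ → E := fun q => extChartAt I x (γ (Circle.exp q.1) q.2)
  have hD : UniqueDiffOn ℝ D := by
    rw [show D = Set.univ ×ˢ timeInterval τ ∩ V from Set.inter_comm _ _]
    exact (uniqueDiffOn_univ.prod (uniqueDiffOn_timeInterval hτ)).inter hV
  have hf' : ContinuousOn (fderivWithin ℝ f D) D := hsm.continuousOn_fderivWithin hD (by simp)
  have hmaps : Set.MapsTo f D (extChartAt I x).target := fun q hq =>
    (extChartAt I x).map_source (hVx q hq)
  have hG : ContinuousOn (fun q => chartMetric I g x (f q)) D :=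
    (hg.smooth x).continuousOn.comp hsm.continuousOn hmaps
  have hη : ContinuousOn (fun q => chartForm I θ x (f q)) D :=
    (hθ.smooth x).continuousOn.comp hsm.continuousOn hmaps
  have hmetric : ∀ e, ContinuousOn (fun q => chartMetric I g x (f q) (fderivWithin ℝ f D q e)
      (fderivWithin ℝ f D q e)) D := fun e =>
    (hG.clm_apply (hf'.clm_apply continuousOn_const)).clm_apply (hf'.clm_apply continuousOn_const)
  have hnhds : nhdsWithin (a, t) D = nhdsWithin (a, t) (Set.univ ×ˢ timeInterval τ) := by
    rw [show D = Set.univ ×ˢ timeInterval τ ∩ V from Set.inter_comm _ _]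
    exact nhdsWithin_inter_of_mem' (mem_nhdsWithin_of_mem_nhds (hV.mem_nhds hmem))
  have hqD : (a, t) ∈ D := ⟨hmem, hq⟩
  have hspeed : ∀ q ∈ D, chartMetric I g x (f q) (fderivWithin ℝ f D q (1, 0))
      (fderivWithin ℝ f D q (1, 0)) = metricAt I g (γ (Circle.exp q.1) q.2)
        (modelVelocity I (angular fun z => γ z q.2) q.1)
        (modelVelocity I (angular fun z => γ z q.2) q.1) := fun q hq => by
    rw [(hder q hq).1, chartMetric_chartDeriv g (hVx q hq)]
  constructor
  · have hc : ContinuousOn (fun q : ℝ × ℝ => curvatureSq I g γ q.1 q.2) D :=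
      (hmetric (0, 1)).congr fun q hq => by
        beta_reduce
        rw [(hder q hq).2, chartMetric_chartDeriv g (hVx q hq), curvatureSq]
    have := hc (a, t) hqD
    rwa [ContinuousWithinAt, hnhds] at this
  · have hne : ∀ q ∈ D, √(chartMetric I g x (f q) (fderivWithin ℝ f D q (1, 0))
        (fderivWithin ℝ f D q (1, 0))) ≠ 0 := by
      intro q hq
      rw [hspeed q hq]
      exact (Real.sqrt_pos.2 (hg.pos _ _ ((h.immersed q.2 hq.2.2).2 q.1))).ne'
    have hc : ContinuousOn (fun q : ℝ × ℝ => formTangent I g θ γ q.1 q.2) D := by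
      refine (((hmetric (1, 0)).sqrt.inv₀ hne).mul
        (hη.clm_apply (hf'.clm_apply (continuousOn_const (c := ((1, 0) : ℝ × ℝ)))))).congr
        fun q hq => ?_
      simp only [Pi.mul_apply, Pi.inv_apply]
      rw [hspeed q hq, (hder q hq).1, chartForm_chartDeriv (hVx q hq), formTangent,
        modelTangent_eq, map_smul, smul_eq_mul, speed_eq]
      rfl
    have := hc (a, t) hqD
    rwa [ContinuousWithinAt, hnhds] at this

lemma exists_curvatureSq_lt (hτ : 0 < τ) (hg : IsSmoothMetric g) (hθ : IsParallelForm I g θ)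
    (h0 : ∀ a, 0 < formTangent I g θ γ a 0) :
    ∃ B > 0, ∀ a, curvatureSq I g γ a 0 < B * formTangent I g θ γ a 0 ^ 2 := by
  obtain ⟨hcK, hcT⟩ := h.continuousOn_curvatureSq_formTangent hτ hg hθ
  have h0mem : (0 : ℝ) ∈ timeInterval τ := ⟨le_rfl, by exact_mod_cast hτ⟩
  have hpi : 0 < 2 * Real.pi := by positivity
  have hmaps : Set.MapsTo (fun a : ℝ => (a, (0 : ℝ))) (Set.Icc 0 (2 * Real.pi))
    (Set.univ ×ˢ timeInterval τ) := fun a _ => ⟨Set.mem_univ _, h0mem⟩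
  have hc : ContinuousOn (fun a => curvatureSq I g γ a 0 / formTangent I g θ γ a 0 ^ 2)
      (Set.Icc 0 (2 * Real.pi)) :=
    (hcK.comp (by fun_prop) hmaps).div ((hcT.comp (by fun_prop) hmaps).pow 2)
      fun a _ => (pow_pos (h0 a) 2).ne'
  obtain ⟨m, -, hm⟩ := isCompact_Icc.exists_isMaxOn (Set.nonempty_Icc.2 hpi.le) hc
  -- The maximum of the ratio over one period, enlarged by one so that the bound is strict and
  -- positive.
  refine ⟨max (curvatureSq I g γ m 0 / formTangent I g θ γ m 0 ^ 2) 0 + 1, by positivity,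
    fun a => ?_⟩
  rw [← div_lt_iff₀ (pow_pos (h0 a) 2)]
  have hper : Function.Periodic (fun a => curvatureSq I g γ a 0 / formTangent I g θ γ a 0 ^ 2)
      (2 * Real.pi) := fun a => by
    have h1 := h.periodic_formTangent (θ := θ) h0mem a
    have h2 := h.periodic_curvatureSq h0mem a
    simp only at h1 h2
    simp only [h1, h2]
  obtain ⟨b, hb, e⟩ := hper.exists_mem_Ico₀ hpi a
  have h1 := hm (Set.Ico_subset_Icc_self hb)
  simp only [Set.mem_ofPred_eq] at h1
  rw [e]
  exact (h1.trans (le_max_left _ _)).trans_lt (lt_add_one _)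

/-! ### From the chart to the manifold: the two global estimates. -/

variable [FiniteDimensional ℝ E]

/-- Near a point with positive time, the flow is a curve shortening flow in a chart. -/
lemma exists_isChartFlow (hτ : 0 < τ) (hg : IsSmoothMetric g) (hθ : IsParallelForm I g θ)
    {a t : ℝ} (ht : t ∈ timeInterval τ) (ht0 : 0 < t) :
    ∃ (f : ℝ × ℝ → E) (Ω : Set (ℝ × ℝ)),
      f (a, t) = extChartAt I (γ (Circle.exp a) t) (γ (Circle.exp a) t) ∧ (a, t) ∈ Ω ∧
      (∀ q ∈ Ω, 0 ≤ q.2) ∧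
      IsChartFlow (chartMetric I g (γ (Circle.exp a) t)) (extChartAt I (γ (Circle.exp a) t)).target
        (chartForm I θ (γ (Circle.exp a) t)) f Ω ∧
      (∀ q ∈ Ω, chartMetric I g (γ (Circle.exp a) t) (f q) (chartVelocity f q) (chartVelocity f q)
        = curvatureSq I g γ q.1 q.2) ∧
      ∀ q ∈ Ω, chartForm I θ (γ (Circle.exp a) t) (f q)
        (chartTangent (chartMetric I g (γ (Circle.exp a) t)) f q) =
          formTangent I g θ γ q.1 q.2 := by
  obtain ⟨V, hV, hmem, hVx⟩ := h.exists_chart_domain (a := a) ht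
  obtain ⟨hsm, hder⟩ := h.exists_chart hτ _ hV hVx
  set x := γ (Circle.exp a) t
  set D := V ∩ Set.univ ×ˢ timeInterval τ
  set f : ℝ × ℝ → E := fun q => extChartAt I x (γ (Circle.exp q.1) q.2)
  -- Time zero is left out to make the domain open, so that derivatives within the domain become
  -- ordinary ones.
  set Ω : Set (ℝ × ℝ) := V ∩ Set.univ ×ˢ {t : ℝ | 0 < t ∧ (t : EReal) < τ} with hΩdef
  have hΩ : IsOpen Ω := hV.inter (isOpen_univ.prod (isOpen_time τ))
  have hΩD : Ω ⊆ D := fun q hq => ⟨hq.1, Set.mem_univ _, hq.2.2.1.le, hq.2.2.2⟩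
  have hfd : ∀ q ∈ Ω, fderivWithin ℝ f D q = fderiv ℝ f q := fun q hq =>
    fderivWithin_of_mem_nhds (Filter.mem_of_superset (hΩ.mem_nhds hq) hΩD)
  have hb : ∀ q ∈ Ω, fderiv ℝ f q (1, 0) = chartDeriv I x (γ (Circle.exp q.1) q.2)
      (modelVelocity I (angular fun z => γ z q.2) q.1) := fun q hq => by
    rw [← hfd q hq, (hder q (hΩD hq)).1]
  have ht' : ∀ q ∈ Ω, fderiv ℝ f q (0, 1) = chartDeriv I x (γ (Circle.exp q.1) q.2)
      (modelCurvature I g (angular fun z => γ z q.2) q.1) := fun q hq => by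
    rw [← hfd q hq, (hder q (hΩD hq)).2]
  have hspeed : ∀ q ∈ Ω, chartSpeed (chartMetric I g x) f q =
      speed I g (angular fun z => γ z q.2) q.1 := fun q hq => by
    rw [chartSpeed, hb q hq, chartMetric_chartDeriv g (hVx q (hΩD hq)), speed_eq]
    rfl
  have htan : ∀ q ∈ Ω, chartTangent (chartMetric I g x) f q =
      chartDeriv I x (γ (Circle.exp q.1) q.2)
        (modelTangent I g (angular fun z => γ z q.2) q.1) := fun q hq => by
    rw [chartTangent, hspeed q hq, hb q hq, modelTangent_eq, map_smul]
  have hmaps : Set.MapsTo f Ω (extChartAt I x).target := fun q hq =>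
    (extChartAt I x).map_source (hVx q (hΩD hq))
  have himm : ∀ q ∈ Ω, fderiv ℝ f q (1, 0) ≠ 0 := fun q hq h0 => by
    refine (h.immersed q.2 (hΩD hq).2.2).2 q.1 ?_
    rw [hb q hq] at h0
    have h1 := chartSymmDeriv_chartDeriv (hVx q (hΩD hq))
      (modelVelocity I (angular fun z => γ z q.2) q.1)
    rw [h0, map_zero] at h1
    exact h1.symm
  have hfs : ContDiffOn ℝ ∞ f Ω := hsm.mono hΩD
  have hGl := hg.isLocalMetric x
  -- Smoothness of T is already needed to verify the evolution equation in `IsChartFlow`, before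
  -- `contDiffOn_tangent` is available.
  have htans : ContDiffOn ℝ ∞ (chartTangent (chartMetric I g x) f) Ω := by
    have hb' := contDiffOn_fderiv_apply hΩ hfs (1, 0)
    have hm := ((hGl.smooth.comp hfs hmaps).clm_apply hb').clm_apply hb'
    have hpos : ∀ q ∈ Ω, 0 < chartMetric I g x (f q) (fderiv ℝ f q (1, 0))
        (fderiv ℝ f q (1, 0)) := fun q hq => hGl.pos _ (hmaps hq) _ (himm q hq)
    exact ((hm.sqrt fun q hq => (hpos q hq).ne').inv
      fun q hq => (Real.sqrt_pos.2 (hpos q hq)).ne').smul hb'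
  refine ⟨f, Ω, rfl, ⟨hmem, Set.mem_univ _, ht0, ht.2⟩, fun q hq => hq.2.2.1.le, ?_, ?_, ?_⟩
  · refine ⟨hGl, hθ.smooth x, hθ.parallel x, hΩ, hfs, hmaps, himm, fun q hq => ?_⟩
    have hline : HasDerivAt (fun b : ℝ => (b, q.2)) ((1, 0) : ℝ × ℝ) q.1 :=
      (hasDerivAt_id q.1).prodMk (hasDerivAt_const q.1 q.2)
    have hT : HasDerivAt (fun b => chartTangent (chartMetric I g x) f (b, q.2))
        (fderiv ℝ (chartTangent (chartMetric I g x) f) q (1, 0)) q.1 :=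
      (differentiableAt_of_contDiffOn hΩ htans hq).hasFDerivAt.comp_hasDerivAt_of_eq q.1 hline rfl
    have hev : ∀ᶠ b in nhds q.1, (b, q.2) ∈ Ω :=
      hline.continuousAt.eventually_mem (hΩ.mem_nhds hq)
    have hT' : HasDerivAt (fun b => chartDeriv I x (angular (fun z => γ z q.2) b)
        (modelTangent I g (angular fun z => γ z q.2) b))
        (fderiv ℝ (chartTangent (chartMetric I g x) f) q (1, 0)) q.1 := by
      refine hT.congr_of_eventuallyEq ?_
      filter_upwards [hev] with b hb using (htan _ hb).symm
    have hx : HasDerivAt (fun b => extChartAt I x (angular (fun z => γ z q.2) b))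
        (fderiv ℝ f q (1, 0)) q.1 :=
      (differentiableAt_of_contDiffOn hΩ hfs hq).hasFDerivAt.comp_hasDerivAt_of_eq q.1 hline rfl
    have hcurv := chartDeriv_modelCurvature hg
      (h.mdifferentiable_angular (hΩD hq).2.2 q.1) (hVx q (hΩD hq)) hT'.differentiableAt
    rw [hT'.deriv, hx.deriv] at hcurv
    rw [chartVelocity, ht' q hq, hspeed q hq, covAlong, htan q hq]
    exact hcurv
  · intro q hq
    rw [chartVelocity, ht' q hq, chartMetric_chartDeriv g (hVx q (hΩD hq)), curvatureSq]
  · intro q hq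
    rw [htan q hq, chartForm_chartDeriv (hVx q (hΩD hq)), formTangent]

/-- A parallel one-form that is positive on the initial tangent vectors stays positive. -/
theorem formTangent_pos (hτ : 0 < τ) (hg : IsSmoothMetric g) (hθ : IsParallelForm I g θ)
    (h0 : ∀ a, 0 < formTangent I g θ γ a 0) :
    ∀ t ∈ timeInterval τ, ∀ a, 0 < formTangent I g θ γ a t := by
  have hcont := (h.continuousOn_curvatureSq_formTangent hτ hg hθ).2
  have h0mem : (0 : ℝ) ∈ timeInterval τ := ⟨le_rfl, by exact_mod_cast hτ⟩
  have hpi : 0 < 2 * Real.pi := by positivity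
  obtain ⟨δ, hδ, hlt⟩ : ∃ δ > 0, ∀ a, δ < formTangent I g θ γ a 0 := by
    have hc : ContinuousOn (fun a => formTangent I g θ γ a 0) (Set.Icc 0 (2 * Real.pi)) :=
      hcont.comp (f := fun a : ℝ => (a, (0 : ℝ))) (by fun_prop)
        fun a _ => ⟨Set.mem_univ _, h0mem⟩
    obtain ⟨m, -, hm⟩ := isCompact_Icc.exists_isMinOn (Set.nonempty_Icc.2 hpi.le) hc
    -- Half the minimum keeps the inequality at time zero strict.
    refine ⟨formTangent I g θ γ m 0 / 2, half_pos (h0 m), fun a => ?_⟩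
    obtain ⟨b, hb, e⟩ := (h.periodic_formTangent (θ := θ) h0mem).exists_mem_Ico₀ hpi a
    have := hm (Set.Ico_subset_Icc_self hb)
    simp only [Set.mem_ofPred_eq] at this
    rw [e]
    linarith [h0 m]
  have key := neg_of_no_first_zero (S := timeInterval τ) (c := 2 * Real.pi)
    (w := fun a t => δ * Real.exp (-t) - formTangent I g θ γ a t)
    (fun t ht => timeInterval_icc ht) (ContinuousOn.sub (by fun_prop) hcont) hpi
    (fun t ht a => by
      have := h.periodic_formTangent (θ := θ) ht a
      simp only at this
      simp only [this])
    (fun a => by simpa using hlt a)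
    (fun a t ht ht0 hz hspace htime => by
      obtain ⟨f, Ω, -, hmem, hΩ0, hflow, -, hform⟩ := h.exists_isChartFlow hτ hg hθ (a := a) ht ht0
      refine hflow.no_first_zero_form hmem hδ ?_ (fun b hb => ?_) (fun s hs hsΩ => ?_)
      · rw [hform _ hmem]; exact hz
      · rw [hform _ hb]; exact hspace b
      · rw [hform _ hsΩ]; exact (htime s (hΩ0 _ hsΩ) hs).le)
  intro t ht a
  have h1 := key t ht a
  have h2 : 0 < δ * Real.exp (-t) := by positivity
  linarith

/-- The ratio of the curvature and the value of a parallel one-form on the tangent vector grows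
at most exponentially, with the upper bound of the sectional curvature as rate. -/
theorem curvatureSq_le (hτ : 0 < τ) (hg : IsSmoothMetric g) (hθ : IsParallelForm I g θ)
    (h0 : ∀ a, 0 < formTangent I g θ γ a 0) {Ξ : ℝ} (hsec : SectionalCurvatureLE I g Ξ) {B : ℝ}
    (hB : 0 < B) (hB0 : ∀ a, curvatureSq I g γ a 0 < B * formTangent I g θ γ a 0 ^ 2) :
    ∀ t ∈ timeInterval τ, ∀ a,
      curvatureSq I g γ a t ≤ B * Real.exp (2 * Ξ * t) * formTangent I g θ γ a t ^ 2 := by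
  obtain ⟨hcK, hcT⟩ := h.continuousOn_curvatureSq_formTangent hτ hg hθ
  have hpos := h.formTangent_pos hτ hg hθ h0
  have hpi : 0 < 2 * Real.pi := by positivity
  -- A rate strictly above Ξ excludes a first zero; c tends to Ξ afterwards.
  have key : ∀ c, Ξ < c → ∀ t ∈ timeInterval τ, ∀ a, curvatureSq I g γ a t -
      B * Real.exp (2 * c * t) * formTangent I g θ γ a t ^ 2 < 0 := by
    intro c hc
    refine neg_of_no_first_zero (S := timeInterval τ) (c := 2 * Real.pi)
      (fun t ht => timeInterval_icc ht) (hcK.sub (ContinuousOn.mul (by fun_prop) (hcT.pow 2))) hpi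
      (fun t ht a => ?_) (fun a => ?_) (fun a t ht ht0 hz hspace htime => ?_)
    · have h1 := h.periodic_formTangent (θ := θ) ht a
      have h2 := h.periodic_curvatureSq ht a
      simp only at h1 h2
      simp only [h1, h2]
    · simpa using hB0 a
    · obtain ⟨f, Ω, hf, hmem, hΩ0, hflow, hcurv, hform⟩ :=
        h.exists_isChartFlow hτ hg hθ (a := a) ht ht0
      refine hflow.no_first_zero_curvature hmem hB hc ?_ ?_
        (w := fun q => curvatureSq I g γ q.1 q.2 -
          B * Real.exp (2 * c * q.2) * formTangent I g θ γ q.1 q.2 ^ 2)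
        (fun q hq => by rw [hcurv q hq, hform q hq]) hz (fun b _ => hspace b)
        (fun s hs hsΩ => (htime s (hΩ0 _ hsΩ) hs).le)
      · intro v w hvw
        rw [hf]
        have hsrc := mem_extChartAt_source (I := I) (γ (Circle.exp a) t)
        have hD : ∀ v, chartDeriv I (γ (Circle.exp a) t) (γ (Circle.exp a) t)
            (chartSymmDeriv I (γ (Circle.exp a) t)
              (extChartAt I (γ (Circle.exp a) t) (γ (Circle.exp a) t)) v) = v := fun v => by
          have := chartDeriv_chartSymmDeriv ((extChartAt I _).map_source hsrc) v
          rwa [(extChartAt I _).left_inv hsrc] at this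
        -- The curvature bound concerns tangent vectors, so `v` and `w` are pulled back by the
        -- chart; independence can be tested after mapping them forward again.
        have hli : LinearIndependent ℝ ![chartSymmDeriv I (γ (Circle.exp a) t)
              (extChartAt I (γ (Circle.exp a) t) (γ (Circle.exp a) t)) v,
            chartSymmDeriv I (γ (Circle.exp a) t)
              (extChartAt I (γ (Circle.exp a) t) (γ (Circle.exp a) t)) w] := by
          refine LinearIndependent.of_comp
            (chartDeriv I (γ (Circle.exp a) t) (γ (Circle.exp a) t)).toLinearMap ?_
          convert hvw using 1
          ext i
          fin_cases i
          · exact hD v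
          · exact hD w
        have := hsec (γ (Circle.exp a) t) _ _ hli
        rwa [sectionalCurvature_eq, hD, hD] at this
      · rw [hform _ hmem]
        exact hpos t ht a
  intro t ht a
  have hlim : Filter.Tendsto (fun c => B * Real.exp (2 * c * t) * formTangent I g θ γ a t ^ 2)
      (nhdsWithin Ξ (Set.Ioi Ξ)) (nhds (B * Real.exp (2 * Ξ * t) *
        formTangent I g θ γ a t ^ 2)) := by
    refine (Continuous.tendsto ?_ Ξ).mono_left nhdsWithin_le_nhds
    fun_prop
  refine ge_of_tendsto hlim ?_
  filter_upwards [self_mem_nhdsWithin] with c hc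
  linarith [key c hc t ht a]

end

end IsCurveShorteningFlow
end Manifold

/-! ### The angular form of the circle -/

section CircleForm

open ComplexConjugate

/-- The derivative of the inclusion of the unit circle into `ℂ`. -/
def circleCoeDeriv (z : Circle) : EuclideanSpace ℝ (Fin 1) →L[ℝ] ℂ :=
  mfderiv (𝓡 1) 𝓘(ℝ, ℂ) (fun z' : Circle => (z' : ℂ)) z

/-- The angular form of the circle. -/
def circleForm (z : Circle) : EuclideanSpace ℝ (Fin 1) →L[ℝ] ℝ :=
  Complex.imCLM.comp ((ContinuousLinearMap.mul ℝ ℂ (conj (z : ℂ))).comp (circleCoeDeriv z))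

lemma circleForm_apply (z : Circle) (v : EuclideanSpace ℝ (Fin 1)) :
    circleForm z v = (conj (z : ℂ) * circleCoeDeriv z v).im := rfl

lemma contMDiff_circle_coe : ContMDiff (𝓡 1) 𝓘(ℝ, ℂ) ∞ (fun z : Circle => (z : ℂ)) :=
  have := finrank_real_complex_fact'
  contMDiff_coe_sphere

lemma circleCoeDeriv_injective (z : Circle) : Function.Injective (circleCoeDeriv z) :=
  have := finrank_real_complex_fact'
  injective_mvfderiv_subtypeVal_sphere (n := 1) (E := ℂ) z

/-- A tangent vector is orthogonal to its base point z, so multiplication by the conjugate of z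
makes it purely imaginary. -/
lemma re_conj_mul_circleCoeDeriv (z : Circle) (v : EuclideanSpace ℝ (Fin 1)) :
    (conj (z : ℂ) * circleCoeDeriv z v).re = 0 := by
  have := finrank_real_complex_fact'
  have h := range_mvfderiv_subtypeVal (n := 1) (E := ℂ) z
  have h1 : circleCoeDeriv z v ∈ (Submodule.span ℝ {(z : ℂ)})ᗮ := by
    rw [← h]
    exact ⟨v, rfl⟩
  have h2 := Submodule.mem_orthogonal_singleton_iff_inner_right.1 h1
  rwa [Complex.inner, mul_comm] at h2

/-- Multiplication by the conjugate of z is an isometry taking tangent vectors to imaginary numbers,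
whose imaginary parts are the values of the angular form. -/
lemma circleMetric_eq (z : Circle) (v w : EuclideanSpace ℝ (Fin 1)) :
    metricAt (𝓡 1) circleMetric z v w = circleForm z v * circleForm z w := by
  have h1 : metricAt (𝓡 1) circleMetric z v w =
      (conj (circleCoeDeriv z v) * circleCoeDeriv z w).re := by
    rw [mul_comm, ← Complex.inner]; rfl
  have h2 : conj (circleCoeDeriv z v) * circleCoeDeriv z w =
      conj (conj (z : ℂ) * circleCoeDeriv z v) * (conj (z : ℂ) * circleCoeDeriv z w) := by
    have : (z : ℂ) * conj (z : ℂ) = 1 := by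
      rw [Complex.mul_conj, Circle.normSq_coe, Complex.ofReal_one]
    simp only [map_mul, Complex.conj_conj]
    linear_combination (-(conj (circleCoeDeriv z v) * circleCoeDeriv z w)) * this
  rw [h1, h2, Complex.mul_re, Complex.conj_re, Complex.conj_im, re_conj_mul_circleCoeDeriv,
    circleForm_apply, circleForm_apply]
  ring

lemma circleForm_ne_zero (z : Circle) {v : EuclideanSpace ℝ (Fin 1)} (hv : v ≠ 0) :
    circleForm z v ≠ 0 := by
  intro h
  rw [circleForm_apply] at h
  have h1 : conj (z : ℂ) * circleCoeDeriv z v = 0 :=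
    Complex.ext (re_conj_mul_circleCoeDeriv z v) h
  have h2 : circleCoeDeriv z v = 0 := (mul_eq_zero.1 h1).resolve_left (by simp)
  exact hv (circleCoeDeriv_injective z (by rw [h2, map_zero]))

/-- The inclusion of the circle into `ℂ` in the preferred chart around `x`. -/
def circleChartCoe (x : Circle) (y : EuclideanSpace ℝ (Fin 1)) : ℂ :=
  ((extChartAt (𝓡 1) x).symm y : Circle)

lemma contDiffOn_circleChartCoe (x : Circle) :
    ContDiffOn ℝ ∞ (circleChartCoe x) (extChartAt (𝓡 1) x).target :=
  (contMDiff_circle_coe.comp_contMDiffOn (contMDiffOn_extChartAt_symm x)).contDiffOn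

lemma fderiv_circleChartCoe {x : Circle} {y : EuclideanSpace ℝ (Fin 1)}
    (hy : y ∈ (extChartAt (𝓡 1) x).target) (v : EuclideanSpace ℝ (Fin 1)) :
    fderiv ℝ (circleChartCoe x) y v =
      circleCoeDeriv ((extChartAt (𝓡 1) x).symm y) (chartSymmDeriv (𝓡 1) x y v) := by
  have h := mfderiv_comp (I := 𝓘(ℝ, EuclideanSpace ℝ (Fin 1))) (I' := 𝓡 1) (I'' := 𝓘(ℝ, ℂ)) y
    ((contMDiff_circle_coe _).mdifferentiableAt (by simp)) (mdifferentiableAt_extChartAt_symm hy)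
  rw [mfderiv_eq_fderiv] at h
  exact DFunLike.congr_fun h v

lemma chartForm_circleForm {x : Circle} {y : EuclideanSpace ℝ (Fin 1)}
    (hy : y ∈ (extChartAt (𝓡 1) x).target) :
    chartForm (𝓡 1) circleForm x y = Complex.imCLM.comp
      ((ContinuousLinearMap.mul ℝ ℂ (conj (circleChartCoe x y))).comp
        (fderiv ℝ (circleChartCoe x) y)) := by
  ext v
  simp only [ContinuousLinearMap.comp_apply, fderiv_circleChartCoe hy]
  rfl

lemma contDiffOn_chartForm_circleForm (x : Circle) :
    ContDiffOn ℝ ∞ (chartForm (𝓡 1) circleForm x) (extChartAt (𝓡 1) x).target := by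
  have h1 := contDiffOn_circleChartCoe x
  have h2 := h1.fderiv_of_isOpen (isOpen_extChartAt_target x) (m := ∞) (by simp)
  refine ContDiffOn.congr ?_ fun y hy => chartForm_circleForm hy
  refine contDiffOn_const.clm_comp (ContDiffOn.clm_comp ?_ h2)
  exact (ContinuousLinearMap.mul ℝ ℂ).contDiff.comp_contDiffOn
    (Complex.conjCLE.contDiff.comp_contDiffOn h1)

/-- Closedness of the angular form, for dimension reasons: two vectors on a line are proportional,
and a bilinear form there is symmetric. -/
lemma fderiv_chartForm_circleForm_symm {x : Circle} {y : EuclideanSpace ℝ (Fin 1)}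
    (v w : EuclideanSpace ℝ (Fin 1)) :
    fderiv ℝ (chartForm (𝓡 1) circleForm x) y v w =
      fderiv ℝ (chartForm (𝓡 1) circleForm x) y w v := by
  obtain ⟨r, hr⟩ : ∃ r : ℝ, w = r • v ∨ v = r • w := by
    rcases eq_or_ne (v 0) 0 with h | h
    · refine ⟨0, Or.inr ?_⟩
      ext i
      fin_cases i
      simpa using h
    · refine ⟨w 0 / v 0, Or.inl ?_⟩
      ext i
      fin_cases i
      simp [h]
  rcases hr with rfl | rfl <;> simp

end CircleForm

/-! ### The product with the circle -/

section Product

variable {n : ℕ} {M : Type*} [TopologicalSpace M] [ChartedSpace (EuclideanSpace ℝ (Fin n)) M]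

/-- The angular form on `M × S¹`. -/
def productForm (p : M × Circle) :
    EuclideanSpace ℝ (Fin n) × EuclideanSpace ℝ (Fin 1) →L[ℝ] ℝ :=
  (circleForm p.2).comp (ContinuousLinearMap.snd ℝ _ _)

lemma metricAt_productMetric (g : ∀ x : M, TangentSpace (𝓡 n) x →L[ℝ] TangentSpace (𝓡 n) x →L[ℝ] ℝ)
    (p : M × Circle) (v w : EuclideanSpace ℝ (Fin n) × EuclideanSpace ℝ (Fin 1)) :
    metricAt ((𝓡 n).prod (𝓡 1)) (productMetric g) p v w =
      metricAt (𝓡 n) g p.1 v.1 w.1 + circleForm p.2 v.2 * circleForm p.2 w.2 := by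
  rw [← circleMetric_eq]
  have h1 := mfderiv_fst (I := 𝓡 n) (I' := 𝓡 1) (x := p)
  have h2 := mfderiv_snd (I := 𝓡 n) (I' := 𝓡 1) (x := p)
  simp only [metricAt, productMetric, h1, h2]
  rfl

lemma mem_target_prod {p : M × Circle} {y : EuclideanSpace ℝ (Fin n) × EuclideanSpace ℝ (Fin 1)}
    (hy : y ∈ (extChartAt ((𝓡 n).prod (𝓡 1)) p).target) :
    y.1 ∈ (extChartAt (𝓡 n) p.1).target ∧ y.2 ∈ (extChartAt (𝓡 1) p.2).target := by
  rw [extChartAt_prod, PartialEquiv.prod_target] at hy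
  exact hy

lemma extChartAt_prod_symm_apply (p : M × Circle)
    (y : EuclideanSpace ℝ (Fin n) × EuclideanSpace ℝ (Fin 1)) :
    (extChartAt ((𝓡 n).prod (𝓡 1)) p).symm y =
      ((extChartAt (𝓡 n) p.1).symm y.1, (extChartAt (𝓡 1) p.2).symm y.2) := by
  rw [extChartAt_prod]
  rfl

variable [IsManifold (𝓡 n) ∞ M]

lemma chartSymmDeriv_prod {p : M × Circle}
    {y : EuclideanSpace ℝ (Fin n) × EuclideanSpace ℝ (Fin 1)}
    (hy : y ∈ (extChartAt ((𝓡 n).prod (𝓡 1)) p).target)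
    (v : EuclideanSpace ℝ (Fin n) × EuclideanSpace ℝ (Fin 1)) :
    chartSymmDeriv ((𝓡 n).prod (𝓡 1)) p y v =
      (chartSymmDeriv (𝓡 n) p.1 y.1 v.1, chartSymmDeriv (𝓡 1) p.2 y.2 v.2) := by
  have hy' := mem_target_prod hy
  have h1 : ((extChartAt ((𝓡 n).prod (𝓡 1)) p).symm :
      EuclideanSpace ℝ (Fin n) × EuclideanSpace ℝ (Fin 1) → M × Circle) =
      fun y => ((extChartAt (𝓡 n) p.1).symm y.1, (extChartAt (𝓡 1) p.2).symm y.2) :=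
    funext fun y => extChartAt_prod_symm_apply p y
  have hfst : MDifferentiableAt 𝓘(ℝ, EuclideanSpace ℝ (Fin n) × EuclideanSpace ℝ (Fin 1))
      𝓘(ℝ, EuclideanSpace ℝ (Fin n)) Prod.fst y := differentiableAt_fst.mdifferentiableAt
  have hsnd : MDifferentiableAt 𝓘(ℝ, EuclideanSpace ℝ (Fin n) × EuclideanSpace ℝ (Fin 1))
      𝓘(ℝ, EuclideanSpace ℝ (Fin 1)) Prod.snd y := differentiableAt_snd.mdifferentiableAt
  have hM := mdifferentiableAt_extChartAt_symm hy'.1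
  have hS := mdifferentiableAt_extChartAt_symm hy'.2
  have c1 := mfderiv_comp y hM hfst
  have c2 := mfderiv_comp y hS hsnd
  rw [mfderiv_eq_fderiv, fderiv_fst] at c1
  rw [mfderiv_eq_fderiv, fderiv_snd] at c2
  have c3 := mfderiv_prodMk (hM.comp y hfst) (hS.comp y hsnd)
  rw [c1, c2] at c3
  -- The type of `mfderiv` depends on the inverse chart, which is therefore replaced by substitution
  -- instead of rewriting.
  have h3 : ∀ f : EuclideanSpace ℝ (Fin n) × EuclideanSpace ℝ (Fin 1) → M × Circle,
      (extChartAt ((𝓡 n).prod (𝓡 1)) p).symm = f → chartSymmDeriv ((𝓡 n).prod (𝓡 1)) p y v =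
        mfderiv 𝓘(ℝ, EuclideanSpace ℝ (Fin n) × EuclideanSpace ℝ (Fin 1))
          ((𝓡 n).prod (𝓡 1)) f y v := by
    rintro _ rfl; rfl
  exact (h3 _ h1).trans (DFunLike.congr_fun c3 v)

lemma chartForm_productForm {p : M × Circle}
    {y : EuclideanSpace ℝ (Fin n) × EuclideanSpace ℝ (Fin 1)}
    (hy : y ∈ (extChartAt ((𝓡 n).prod (𝓡 1)) p).target) :
    chartForm ((𝓡 n).prod (𝓡 1)) productForm p y =
      (chartForm (𝓡 1) circleForm p.2 y.2).comp (ContinuousLinearMap.snd ℝ _ _) := by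
  refine ContinuousLinearMap.ext fun v => ?_
  simp only [chartForm, productForm, ContinuousLinearMap.comp_apply, chartSymmDeriv_prod hy,
    extChartAt_prod_symm_apply, ContinuousLinearMap.coe_snd']

lemma chartMetric_productMetric
    (g : ∀ x : M, TangentSpace (𝓡 n) x →L[ℝ] TangentSpace (𝓡 n) x →L[ℝ] ℝ) {p : M × Circle}
    {y : EuclideanSpace ℝ (Fin n) × EuclideanSpace ℝ (Fin 1)}
    (hy : y ∈ (extChartAt ((𝓡 n).prod (𝓡 1)) p).target)
    (v w : EuclideanSpace ℝ (Fin n) × EuclideanSpace ℝ (Fin 1)) :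
    chartMetric ((𝓡 n).prod (𝓡 1)) (productMetric g) p y v w =
      chartMetric (𝓡 n) g p.1 y.1 v.1 w.1 +
        chartForm (𝓡 1) circleForm p.2 y.2 v.2 * chartForm (𝓡 1) circleForm p.2 y.2 w.2 := by
  rw [chartMetric_apply, metricAt_productMetric, chartSymmDeriv_prod hy, chartSymmDeriv_prod hy,
    extChartAt_prod_symm_apply, chartMetric_apply]
  rfl

/-! ### Smoothness of the product metric and parallelism of the angular form. -/

variable (g : Bundle.ContMDiffRiemannianMetric (𝓡 n) ∞ (EuclideanSpace ℝ (Fin n))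
      (fun x : M => TangentSpace (𝓡 n) x))

/-- Coordinate fields are images of constant fields under the tangent map of the inverse chart. They
turn smoothness of the bundle metric into smoothness of its coefficients. -/
lemma contMDiffOn_chartSymmDeriv (x : M) (v : EuclideanSpace ℝ (Fin n)) :
    ContMDiffOn 𝓘(ℝ, EuclideanSpace ℝ (Fin n)) (𝓡 n).tangent ∞
      (fun y => (⟨(extChartAt (𝓡 n) x).symm y, chartSymmDeriv (𝓡 n) x y v⟩ :
        TangentBundle (𝓡 n) M)) (extChartAt (𝓡 n) x).target := by
  have ho := isOpen_extChartAt_target (I := 𝓡 n) x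
  have h1 := (contMDiffOn_extChartAt_symm (I := 𝓡 n) (n := ∞) x).contMDiffOn_tangentMapWithin
    (m := ∞) (by simp) ho.uniqueMDiffOn
  have h2 : ContMDiff 𝓘(ℝ, EuclideanSpace ℝ (Fin n)) 𝓘(ℝ, EuclideanSpace ℝ (Fin n)).tangent ∞
      (fun y => (⟨y, v⟩ : TangentBundle 𝓘(ℝ, EuclideanSpace ℝ (Fin n))
        (EuclideanSpace ℝ (Fin n)))) :=
    contMDiff_vectorSpace_iff_contDiff.2 contDiff_const
  refine (h1.comp h2.contMDiffOn fun y hy => hy).congr fun y hy => ?_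
  simp only [tangentMapWithin, Function.comp, mfderivWithin_of_isOpen ho hy]
  rfl

lemma contDiffOn_chartMetric_inner (x : M) :
    ContDiffOn ℝ ∞ (chartMetric (𝓡 n) g.inner x) (extChartAt (𝓡 n) x).target := by
  rw [contDiffOn_clm_apply]
  intro v
  rw [contDiffOn_clm_apply]
  intro w
  rw [← contMDiffOn_iff_contDiffOn]
  intro y hy
  have hb := contMDiffOn_extChartAt_symm (I := 𝓡 n) (n := ∞) x y hy
  have key : ContMDiffWithinAt 𝓘(ℝ, EuclideanSpace ℝ (Fin n)) ((𝓡 n).prod 𝓘(ℝ)) ∞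
      (fun y => Bundle.TotalSpace.mk' ℝ (E := Bundle.Trivial M ℝ) ((extChartAt (𝓡 n) x).symm y)
        (g.inner ((extChartAt (𝓡 n) x).symm y) (chartSymmDeriv (𝓡 n) x y v)
          (chartSymmDeriv (𝓡 n) x y w))) (extChartAt (𝓡 n) x).target y := by
    apply ContMDiffWithinAt.clm_bundle_apply₂ (F₁ := EuclideanSpace ℝ (Fin n))
      (F₂ := EuclideanSpace ℝ (Fin n))
    · exact g.contMDiff.contMDiffAt.comp_contMDiffWithinAt y hb
    · exact contMDiffOn_chartSymmDeriv x v y hy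
    · exact contMDiffOn_chartSymmDeriv x w y hy
  rw [Bundle.contMDiffWithinAt_totalSpace] at key
  exact key.2

lemma isSmoothMetric_productMetric :
    IsSmoothMetric (I := (𝓡 n).prod (𝓡 1)) (productMetric g.inner) where
  symm p v w := by
    rw [metricAt_productMetric, metricAt_productMetric]
    have h : metricAt (𝓡 n) g.inner p.1 v.1 w.1 = metricAt (𝓡 n) g.inner p.1 w.1 v.1 :=
      g.symm p.1 v.1 w.1
    rw [h, mul_comm]
  pos p v hv := by
    rw [metricAt_productMetric]
    have h1 : ∀ w : EuclideanSpace ℝ (Fin n), w ≠ 0 → 0 < metricAt (𝓡 n) g.inner p.1 w w :=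
      fun w hw => g.pos p.1 w hw
    by_cases hv2 : v.2 = 0
    · have hv1 : v.1 ≠ 0 := fun h => hv (Prod.ext h hv2)
      simpa [hv2] using h1 _ hv1
    · have h2 := mul_self_pos.2 (circleForm_ne_zero p.2 hv2)
      by_cases hv1 : v.1 = 0
      · simpa [hv1] using h2
      · exact add_pos (h1 _ hv1) h2
  smooth p := by
    rw [contDiffOn_clm_apply]
    intro v
    rw [contDiffOn_clm_apply]
    intro w
    refine ContDiffOn.congr ?_ fun y hy => chartMetric_productMetric g.inner hy v w
    have h1 : ContDiffOn ℝ ∞ (fun y : EuclideanSpace ℝ (Fin n) × EuclideanSpace ℝ (Fin 1) =>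
        chartMetric (𝓡 n) g.inner p.1 y.1) (extChartAt ((𝓡 n).prod (𝓡 1)) p).target :=
      (contDiffOn_chartMetric_inner g p.1).comp contDiff_fst.contDiffOn
        fun y hy => (mem_target_prod hy).1
    have h2 : ContDiffOn ℝ ∞ (fun y : EuclideanSpace ℝ (Fin n) × EuclideanSpace ℝ (Fin 1) =>
        chartForm (𝓡 1) circleForm p.2 y.2) (extChartAt ((𝓡 n).prod (𝓡 1)) p).target :=
      (contDiffOn_chartForm_circleForm p.2).comp contDiff_snd.contDiffOn
        fun y hy => (mem_target_prod hy).2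
    exact ((h1.clm_apply contDiffOn_const).clm_apply contDiffOn_const).add
      ((h2.clm_apply contDiffOn_const).mul (h2.clm_apply contDiffOn_const))

/-- The angular form is closed and splits off the metric orthogonally, so `parallel_of_splitting`
applies. -/
lemma isParallelForm_productForm :
    IsParallelForm ((𝓡 n).prod (𝓡 1)) (productMetric g.inner) (productForm (M := M)) where
  smooth p := by
    refine ContDiffOn.congr ?_ fun y hy => chartForm_productForm hy
    have h2 : ContDiffOn ℝ ∞ (fun y : EuclideanSpace ℝ (Fin n) × EuclideanSpace ℝ (Fin 1) =>
        chartForm (𝓡 1) circleForm p.2 y.2) (extChartAt ((𝓡 n).prod (𝓡 1)) p).target :=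
      (contDiffOn_chartForm_circleForm p.2).comp contDiff_snd.contDiffOn
        fun y hy => (mem_target_prod hy).2
    exact h2.clm_comp contDiffOn_const
  parallel p y hy v w := by
    have hy2 := (mem_target_prod hy).2
    have ho := isOpen_extChartAt_target (I := (𝓡 n).prod (𝓡 1)) p
    have hd : DifferentiableAt ℝ (chartForm (𝓡 1) circleForm p.2) y.2 :=
      ((contDiffOn_chartForm_circleForm p.2).contDiffAt
        ((isOpen_extChartAt_target p.2).mem_nhds hy2)).differentiableAt (by simp)
    have hne : chartForm (𝓡 1) circleForm p.2 y.2 ≠ 0 := by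
      intro h0
      obtain ⟨v, hv⟩ := exists_ne (0 : EuclideanSpace ℝ (Fin 1))
      have h1 : circleForm ((extChartAt (𝓡 1) p.2).symm y.2) (chartSymmDeriv (𝓡 1) p.2 y.2 v) = 0 :=
        DFunLike.congr_fun h0 v
      refine circleForm_ne_zero _ (fun h2 => hv ?_) h1
      rw [← chartDeriv_chartSymmDeriv hy2 v, h2, map_zero]
    have h1 := ((isSmoothMetric_productMetric g).isLocalMetric p).parallel_of_splitting
      (G₁ := chartMetric (𝓡 n) g.inner p.1) hy hd fderiv_chartForm_circleForm_symm hne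
      (fun y hy v w => chartMetric_productMetric g.inner hy v w) v w
    have h2 : chartForm ((𝓡 n).prod (𝓡 1)) (productForm (M := M)) p =ᶠ[nhds y] fun y =>
        (chartForm (𝓡 1) circleForm p.2 y.2).comp (ContinuousLinearMap.snd ℝ _ _) :=
      Filter.eventually_of_mem (ho.mem_nhds hy) fun y hy => chartForm_productForm hy
    have h3 : HasFDerivAt (fun y : EuclideanSpace ℝ (Fin n) × EuclideanSpace ℝ (Fin 1) =>
        chartForm (𝓡 1) circleForm p.2 y.2)
        ((fderiv ℝ (chartForm (𝓡 1) circleForm p.2) y.2).comp (ContinuousLinearMap.snd ℝ _ _)) y :=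
      hd.hasFDerivAt.comp y hasFDerivAt_snd
    rw [h2.fderiv_eq, chartForm_productForm hy, (h3.clm_comp (hasFDerivAt_const _ y)).fderiv]
    simpa using h1

end Product

/-! ### Ramps -/

section Ramps

open ComplexConjugate

lemma continuous_circleForm_section {U : ∀ z : Circle, TangentSpace (𝓡 1) z}
    (hU : ContMDiff (𝓡 1) (𝓡 1).tangent ∞ (fun z => (⟨z, U z⟩ : TangentBundle (𝓡 1) Circle))) :
    Continuous (fun z => circleForm z (U z)) := by
  have h1 : Continuous (tangentMap (𝓡 1) 𝓘(ℝ, ℂ) (fun z : Circle => (z : ℂ))) :=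
    contMDiff_circle_coe.continuous_tangentMap (by simp)
  have h2 : Continuous (fun z => circleCoeDeriv z (U z)) :=
    (contMDiff_snd_tangentBundle_modelSpace (n := ∞) ℂ 𝓘(ℝ, ℂ)).continuous.comp (h1.comp hU.continuous)
  have h3 : Continuous (fun z : Circle => conj (z : ℂ)) :=
    Complex.continuous_conj.comp contMDiff_circle_coe.continuous
  exact Complex.continuous_im.comp (h3.mul h2)

/-- The scalar product of a smooth unit field on the circle with the angular field is constant. -/
lemma exists_circleForm_eq {U : ∀ z : Circle, TangentSpace (𝓡 1) z}
    (hU : ContMDiff (𝓡 1) (𝓡 1).tangent ∞ (fun z => (⟨z, U z⟩ : TangentBundle (𝓡 1) Circle)))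
    (hunit : ∀ z, circleMetric z (U z) (U z) = 1) :
    ∃ r : ℝ, r * r = 1 ∧ ∀ z, circleForm z (U z) = r := by
  have hsq : ∀ z, circleForm z (U z) * circleForm z (U z) = 1 := fun z =>
    (circleMetric_eq z (U z) (U z)).symm.trans (hunit z)
  have hc := continuous_circleForm_section hU
  have hpre : IsPreconnected (Set.univ : Set Circle) := by
    rw [← Circle.exp_surjective.range_eq]
    exact isPreconnected_range Circle.exp.continuous
  refine ⟨circleForm 1 (U 1), hsq 1, fun z => ?_⟩
  -- A continuous function with square one has constant sign on the connected circle.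
  have h1 : Set.EqOn (fun z => circleForm z (U z)) (fun _ => circleForm 1 (U 1)) Set.univ := by
    refine hpre.eq_of_sq_eq hc.continuousOn continuousOn_const (fun z _ => ?_) (fun {z} _ => ?_)
      (Set.mem_univ 1) rfl
    · simp only [Pi.pow_apply, sq, hsq]
    · exact fun h0 => by simpa [h0] using hsq 1
  exact h1 (Set.mem_univ z)

variable {n : ℕ} {M : Type*} [TopologicalSpace M] [ChartedSpace (EuclideanSpace ℝ (Fin n)) M]

lemma circleMetric_mfderiv_snd {p : M × Circle}
    (v : EuclideanSpace ℝ (Fin n) × EuclideanSpace ℝ (Fin 1)) (u : EuclideanSpace ℝ (Fin 1)) :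
    circleMetric p.2 (mfderiv ((𝓡 n).prod (𝓡 1)) (𝓡 1) (Prod.snd : M × Circle → Circle) p v) u =
      productForm p v * circleForm p.2 u := by
  rw [mfderiv_snd]
  exact circleMetric_eq p.2 v.2 u

/-- The conditions on a ramp in terms of the angular form. -/
lemma ramp_inequality_iff {g : ∀ x : M, TangentSpace (𝓡 n) x →L[ℝ] TangentSpace (𝓡 n) x →L[ℝ] ℝ}
    {U : ∀ z : Circle, TangentSpace (𝓡 1) z} {r : ℝ} (hr : ∀ z, circleForm z (U z) = r)
    (γ : Circle → ℝ → M × Circle) (t a : ℝ) :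
    0 < circleMetric (angular (fun z => γ z t) a).2
      (mfderiv ((𝓡 n).prod (𝓡 1)) (𝓡 1) (Prod.snd : M × Circle → Circle)
        (angular (fun z => γ z t) a)
        (unitTangent ((𝓡 n).prod (𝓡 1)) (productMetric g) (angular fun z => γ z t) a))
      (U (angular (fun z => γ z t) a).2) ↔
    0 < formTangent ((𝓡 n).prod (𝓡 1)) (productMetric g) (fun p => r • productForm p) γ a t := by
  have h1 := circleMetric_mfderiv_snd (p := angular (fun z => γ z t) a)
    (modelTangent ((𝓡 n).prod (𝓡 1)) (productMetric g) (angular fun z => γ z t) a)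
    (U (angular (fun z => γ z t) a).2)
  have h2 := hr (angular (fun z => γ z t) a).2
  have h3 : formTangent ((𝓡 n).prod (𝓡 1)) (productMetric g) (fun p => r • productForm p) γ a t =
      productForm (angular (fun z => γ z t) a)
        (modelTangent ((𝓡 n).prod (𝓡 1)) (productMetric g) (angular fun z => γ z t) a) *
      circleForm (angular (fun z => γ z t) a).2 (U (angular (fun z => γ z t) a).2) := by
    rw [h2, mul_comm]; rfl
  rw [h3, ← h1]
  rfl

/-- Squaring removes the choice of N, so its sign and regularity do not matter. -/
lemma IsSignedCurvature.sq_eq {g : ∀ x : M, TangentSpace (𝓡 n) x →L[ℝ] TangentSpace (𝓡 n) x →L[ℝ] ℝ}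
    {γ : Circle → ℝ → M × Circle} {t : ℝ} {k : Circle → ℝ}
    (hk : IsSignedCurvature ((𝓡 n).prod (𝓡 1)) (productMetric g) (fun z => γ z t) k) (a : ℝ) :
    k (Circle.exp a) ^ 2 = curvatureSq ((𝓡 n).prod (𝓡 1)) (productMetric g) γ a t := by
  obtain ⟨-, N, hN, -, hK⟩ := hk
  obtain ⟨N', hN'⟩ : ∃ N' : EuclideanSpace ℝ (Fin n) × EuclideanSpace ℝ (Fin 1),
    N' = N (Circle.exp a) := ⟨_, rfl⟩
  have h1 : modelCurvature ((𝓡 n).prod (𝓡 1)) (productMetric g) (angular fun z => γ z t) a =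
      k (Circle.exp a) • N' := by rw [hN']; exact hK a
  have h2 : metricAt ((𝓡 n).prod (𝓡 1)) (productMetric g) (γ (Circle.exp a) t) N' N' = 1 := by
    rw [hN']; exact hN (Circle.exp a)
  rw [curvatureSq, h1]
  simp only [map_smul, smul_apply, h2, smul_eq_mul]
  ring

variable [IsManifold (𝓡 n) ∞ M] (g : Bundle.ContMDiffRiemannianMetric (𝓡 n) ∞
  (EuclideanSpace ℝ (Fin n)) (fun x : M => TangentSpace (𝓡 n) x))

/-- The squared length 1 of T is the sum of its nonnegative M-part and the square of the angular
form. -/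
lemma formTangent_sq_le_one {r : ℝ} (hr : r * r = 1) {γ : Circle → ℝ → M × Circle} {t : ℝ}
    (himm : IsImmersedCurve ((𝓡 n).prod (𝓡 1)) (fun z => γ z t)) (a : ℝ) :
    formTangent ((𝓡 n).prod (𝓡 1)) (productMetric g.inner) (fun p => r • productForm p) γ a t ^ 2
      ≤ 1 := by
  have hpos := (isSmoothMetric_productMetric g).pos (γ (Circle.exp a) t)
    (modelVelocity ((𝓡 n).prod (𝓡 1)) (angular fun z => γ z t) a) (himm.2 a)
  have hunit : metricAt ((𝓡 n).prod (𝓡 1)) (productMetric g.inner) (γ (Circle.exp a) t)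
      (modelTangent ((𝓡 n).prod (𝓡 1)) (productMetric g.inner) (angular fun z => γ z t) a)
      (modelTangent ((𝓡 n).prod (𝓡 1)) (productMetric g.inner) (angular fun z => γ z t) a) = 1 := by
    have hs := Real.sq_sqrt hpos.le
    have hs0 := (Real.sqrt_pos.2 hpos).ne'
    rw [modelTangent_eq, speed_eq]
    simp only [map_smul, smul_apply, smul_eq_mul]
    change (√_)⁻¹ * ((√_)⁻¹ * _) = 1
    simp only [angular] at hs hs0 ⊢
    rw [← mul_assoc, ← sq, inv_pow, hs, inv_mul_cancel₀ hpos.ne']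
  rw [metricAt_productMetric] at hunit
  have hnn : ∀ w : EuclideanSpace ℝ (Fin n),
      0 ≤ metricAt (𝓡 n) g.inner (γ (Circle.exp a) t).1 w w := by
    intro w
    rcases eq_or_ne w 0 with rfl | hw
    · simp
    · exact (g.pos _ w hw).le
  have h1 := hnn (modelTangent ((𝓡 n).prod (𝓡 1)) (productMetric g.inner)
    (angular fun z => γ z t) a).1
  have h2 : formTangent ((𝓡 n).prod (𝓡 1)) (productMetric g.inner)
      (fun p => r • productForm p) γ a t =
      r * circleForm (γ (Circle.exp a) t).2 (modelTangent ((𝓡 n).prod (𝓡 1))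
        (productMetric g.inner) (angular fun z => γ z t) a).2 := rfl
  rw [h2, mul_pow, sq r, hr, one_mul, sq]
  linarith

end Ramps

end

theorem proposition18 {n : ℕ} {M : Type*} [TopologicalSpace M] [T2Space M]
    [SecondCountableTopology M] [ChartedSpace (EuclideanSpace ℝ (Fin n)) M] [IsManifold (𝓡 n) ∞ M]
    (g : Bundle.ContMDiffRiemannianMetric (𝓡 n) ∞ (EuclideanSpace ℝ (Fin n))
      (fun x : M => TangentSpace (𝓡 n) x))
    (γ₀ : Circle → M × Circle)
    (hγ₀ : IsImmersedCurve ((𝓡 n).prod (𝓡 1)) γ₀)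
    (hramp : IsRamp g.inner γ₀) :
    ∃ C₁ < (0 : ℝ), ∃ C₂ > (0 : ℝ),
      ∀ Ξ > (0 : ℝ), SectionalCurvatureLE ((𝓡 n).prod (𝓡 1)) (productMetric g.inner) Ξ →
      ∀ τ > (0 : EReal), ∀ γ : Circle → ℝ → M × Circle,
        IsCurveShorteningFlow ((𝓡 n).prod (𝓡 1)) (productMetric g.inner) τ γ →
        (∀ z, γ z 0 = γ₀ z) →
        (∀ t ∈ timeInterval τ, IsRamp g.inner (fun z => γ z t)) ∧
        ∀ k : Circle → ℝ → ℝ,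
          (∀ t ∈ timeInterval τ, IsSignedCurvature ((𝓡 n).prod (𝓡 1)) (productMetric g.inner)
            (fun z => γ z t) (fun z => k z t)) →
          ((∀ t ∈ timeInterval τ, (⨅ z, k z t) < 0) →
            ∀ t ∈ timeInterval τ, ∀ z, C₁ * Real.exp (Ξ * t) ≤ k z t) ∧
          ((∀ t ∈ timeInterval τ, 0 < (⨆ z, k z t)) →
            ∀ t ∈ timeInterval τ, ∀ z, k z t ≤ C₂ * Real.exp (Ξ * t)) := by
  obtain ⟨U, hUs, hUunit, hU⟩ := hramp
  obtain ⟨r, hrr, hr⟩ := exists_circleForm_eq hUs hUunit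
  have hg := isSmoothMetric_productMetric g
  have hθ := (isParallelForm_productForm g).const_smul r
  -- the bound exists by compactness as soon as some flow starts at the curve
  obtain ⟨B, hB, hB0⟩ : ∃ B > (0 : ℝ), (∃ B > (0 : ℝ), ∀ a,
      curvatureSq ((𝓡 n).prod (𝓡 1)) (productMetric g.inner) (fun z _ => γ₀ z) a 0 <
        B * formTangent ((𝓡 n).prod (𝓡 1)) (productMetric g.inner) (fun p => r • productForm p)
          (fun z _ => γ₀ z) a 0 ^ 2) → ∀ a,
      curvatureSq ((𝓡 n).prod (𝓡 1)) (productMetric g.inner) (fun z _ => γ₀ z) a 0 <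
        B * formTangent ((𝓡 n).prod (𝓡 1)) (productMetric g.inner) (fun p => r • productForm p)
          (fun z _ => γ₀ z) a 0 ^ 2 := by
    -- B must depend on the initial curve alone. If no bound exists, the implication is vacuous and
    -- 1 serves as a dummy; a given flow later excludes that case.
    by_cases h : ∃ B > (0 : ℝ), ∀ a,
      curvatureSq ((𝓡 n).prod (𝓡 1)) (productMetric g.inner) (fun z _ => γ₀ z) a 0 <
        B * formTangent ((𝓡 n).prod (𝓡 1)) (productMetric g.inner) (fun p => r • productForm p)
          (fun z _ => γ₀ z) a 0 ^ 2
    · obtain ⟨B, hB, hB0⟩ := h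
      exact ⟨B, hB, fun _ => hB0⟩
    · exact ⟨1, one_pos, fun h' => absurd h' h⟩
  have hsqrt : 0 < √B := Real.sqrt_pos.2 hB
  refine ⟨-√B, neg_neg_of_pos hsqrt, √B, hsqrt, fun Ξ _ hsec τ hτ γ hflow hstart => ?_⟩
  have hγ : (fun z => γ z 0) = γ₀ := funext hstart
  have hK0 : ∀ a, curvatureSq ((𝓡 n).prod (𝓡 1)) (productMetric g.inner) (fun z _ => γ₀ z) a 0 =
      curvatureSq ((𝓡 n).prod (𝓡 1)) (productMetric g.inner) γ a 0 := fun a => by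
    subst hγ; rfl
  have hT0 : ∀ a, formTangent ((𝓡 n).prod (𝓡 1)) (productMetric g.inner)
      (fun p => r • productForm p) (fun z _ => γ₀ z) a 0 = formTangent ((𝓡 n).prod (𝓡 1))
        (productMetric g.inner) (fun p => r • productForm p) γ a 0 := fun a => by
    subst hγ; rfl
  simp only [hK0, hT0] at hB0
  have h0 : ∀ a, 0 < formTangent ((𝓡 n).prod (𝓡 1)) (productMetric g.inner)
      (fun p => r • productForm p) γ a 0 := fun a =>
    (ramp_inequality_iff hr γ 0 a).1 (by rw [hγ]; exact hU a)
  refine ⟨fun t ht => ⟨U, hUs, hUunit, fun a =>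
    (ramp_inequality_iff hr γ t a).2 (hflow.formTangent_pos hτ hg hθ h0 t ht a)⟩, fun k hk => ?_⟩
  have habs : ∀ t ∈ timeInterval τ, ∀ z, |k z t| ≤ √B * Real.exp (Ξ * t) := by
    intro t ht z
    obtain ⟨a, rfl⟩ := Circle.exp_surjective z
    have h1 := hflow.curvatureSq_le hτ hg hθ h0 hsec hB
      (hB0 (hflow.exists_curvatureSq_lt hτ hg hθ h0)) t ht a
    have h2 := formTangent_sq_le_one g hrr (hflow.immersed t ht) a
    have h3 := (hk t ht).sq_eq a
    refine abs_le_of_sq_le_sq ?_ (by positivity)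
    rw [h3, mul_pow, Real.sq_sqrt hB.le, ← Real.exp_nat_mul]
    -- The factor u² ≤ 1 is discarded, turning the bound on the ratio into one on |K|².
    calc _ ≤ _ := h1
      _ ≤ B * Real.exp (2 * Ξ * t) * 1 := by gcongr
      _ = _ := by rw [mul_one]; congr 2; push_cast; ring
  exact ⟨fun _ t ht z => by linarith [neg_le_of_abs_le (habs t ht z)],
    fun _ t ht z => le_of_abs_le (habs t ht z)⟩
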